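/- **Theorem (private all-pairs distances, small feedback vertex set).** Let $G=(V,E)$ be a connected undirected graph with $n=|V|$ vertices and public topology, with private edge weights $w\colon E\to[0,\infty)$; two weight functions are neighbouring if $\sum_{e\in E}|w(e)-w'(e)|\le 1$. Write $d(u,v)$ for the shortest path distance in $(G,w)$. Let $S\subseteq V$ be a feedback vertex set of $G$ (i.e. $G\setminus S$ is a forest) that depends only on the topology, for instance the output of a 2-approximation algorithm for minimum feedback vertex set, and let $k=|S|$. Let $\epsilon>0$, $0<\delta<1$, $\epsilon'=\epsilon/3$, and let $\mathrm{Lap}(b)$ be the centred Laplace law with density $\frac1{2b}e^{-|x|/b}$ (the point mass at $0$ if $b=0$). Consider the following algorithm, in which all noise variables are independent and a minimum over the empty set is $+\infty$. 1. *(Forest distances, Sealfon's algorithm.)* Let $N=|V\setminus S|$ and fix a root in each tree of the forest $G\setminus S$. For a subtree $T$ with top vertex $r$ and at least two vertices, let $v^*$ be the vertex whose subtree in $T$ has more than $|T|/2$ vertices while the subtrees $T_c$ of its children $c\in T$ have at most $|T|/2$ vertices. Put $\hat d(v^*,T)=d_{G\setminus S}(r,v^*)+X_{v^*,T}$ and $\hat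 d(c,T)=\hat d(v^*,T)+w(v^*,c)+X_{c,T}$, with $X_{\cdot,T}\sim \mathrm{Lap}(\lceil\log_2 N\rceil/\epsilon')$. Recursively, $\hat d(x,T)=\hat d(c,T)+\hat d(x,T_c)$ if $x\in T_c$ for a child $c$ of $v^*$, and $\hat d(x,T)=\hat d(x,T\setminus\bigcup_cT_c)$ otherwise, with value $0$ when $|T|=1$. For $x,y$ in the same tree $T$ with lowest common ancestor $z$ put $\hat d_F(x,y)=\hat d(x,T)+\hat d(y,T)-2\hat d(z,T)$; for $x,y$ in different trees put $\hat d_F(x,y)=+\infty$. 2. For all ordered pairs $u,v\in S$ put $\hat d(u,v)=d(u,v)+\mathrm{Lap}(2\sqrt2\,k\sqrt{\log(1/\delta)}/\epsilon')$. 3. For each edge $\{p,v\}$ with $p\notin S$, $v\in S$ put $w'(p,v)=w(p,v)+\mathrm{Lap}(1/\epsilon')$. 4. For $u\notin S$, $v\in S$ put $\hat d_0(u,v)=\min_{p\notin S,\ \{p,v\}\in E}\big(\hat d_F(u,p)+w'(p,v)\big)$, and then $\hat d(u,v)=\hat d(v,u)=\min_{p\in S}\big(\hat d_0(u,p)+\hat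 d(p,v)\big)$. 5. For $u,v\notin S$ put $\hat d(u,v)=\min\Big(\hat d_F(u,v),\ \min_{p\in S}\big(\hat d(u,p)+\hat d(p,v)\big)\Big)$. There is an absolute constant $C>0$ such that for all such $G$, $S$, $\epsilon$, $\delta$: * (Privacy) if $\epsilon'\le 8\log(1/\delta)$ (for instance if $\epsilon'\le1$ and $\delta\le 1/2$), the released distances $(\hat d(u,v))_{u,v\in V}$ are $(\epsilon,\delta)$-differentially private with respect to neighbouring weights; * (Accuracy) for all weights $w\ge 0$ and all $\gamma>0$, with probability at least $1-3\gamma$, simultaneously for all $u,v\in V$, $$|\hat d(u,v)-d(u,v)|\le C\Big(\epsilon^{-1}k\log(k/\gamma)\sqrt{\log(1/\delta)}+\epsilon^{-1}\log^{2.5}(n)\,\log(1/\gamma)\Big),$$ where the first term is $0$ if $k=0$. -/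

import Mathlib

open MeasureTheory
open scoped NNReal ENNReal

universe u

namespace FVSRelease

noncomputable section

/-- The centred Laplace distribution `Lap(0, b)`, with density `exp (-|x| / b) / (2 b)`;
for scale `b ≤ 0` (no noise) it is the point mass at `0`. -/
def laplace (b : ℝ) : Measure ℝ :=
  open Classical in
  if 0 < b then
    volume.withDensity (fun x => ENNReal.ofReal (1 / (2 * b) * Real.exp (-|x| / b)))
  else Measure.dirac 0

/-- The shortest path distance with respect to the weights `w`: the minimum of `∑_{e ∈ P} w e`
over all paths `P` from `u` to `v`. (Used only when `u` and `v` are connected.) -/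
def wdist {V : Type u} (G : SimpleGraph V) (w : Sym2 V → ℝ≥0) (u v : V) : ℝ :=
  ⨅ p : G.Path u v, ((p : G.Walk u v).edges.map (fun e => (w e : ℝ))).sum

/-- Two weight functions on the edges of the (public) graph `G` are neighbouring if
`∑_{e ∈ E} |w e - w' e| ≤ 1`. Values of `w` outside of the edge set are irrelevant. -/
def Neighboring {V : Type u} [Fintype V] [DecidableEq V] (G : SimpleGraph V)
    (w w' : Sym2 V → ℝ≥0) : Prop :=
  open Classical in
  ∑ e : Sym2 V with e ∈ G.edgeSet, |(w e : ℝ) - (w' e : ℝ)| ≤ 1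

/-- `(ε, δ)`-differential privacy of a randomized algorithm `A`, given by its output law
`A x` on each input `x`, for the neighbouring relation `adj`. -/
def IsDP {X Y : Type*} [MeasurableSpace Y] (adj : X → X → Prop) (A : X → Measure Y)
    (ε δ : ℝ) : Prop :=
  ∀ x x' : X, adj x x' → ∀ O : Set Y, MeasurableSet O →
    A x O ≤ ENNReal.ofReal (Real.exp ε) * A x' O + ENNReal.ofReal δ

/-- `S` is a feedback vertex set of `G`: the induced graph on the complement is a forest. -/
def IsFeedbackVertexSet {V : Type u} (G : SimpleGraph V) (S : Finset V) : Prop :=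
  (G.induce {v | v ∉ S}).IsAcyclic

/-! ### All-pairs distances on a forest

The recursive rooted-tree mechanism, run on every tree of a forest `H`, followed by the lowest
common ancestor formula. The noise variable `X (T, v)` is the one drawn for the vertex `v`
when the recursion treats the subtree with vertex set `T`. -/

section Forest

variable {W : Type u} [Fintype W] [DecidableEq W]

/-- A root of the tree (connected component) of `x`. -/
def root (H : SimpleGraph W) (x : W) : W := Quot.out (H.connectedComponentMk x)

/-- `v` is an ancestor of `x` (possibly `x` itself) in the rooted forest: it lies on the path
from the root to `x`. -/
def Anc (H : SimpleGraph W) (v x : W) : Prop :=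
  ∀ p : H.Walk (root H x) x, v ∈ p.support

/-- `c` is a child of `v` in the rooted forest. -/
def IsChild (H : SimpleGraph W) (v c : W) : Prop := H.Adj v c ∧ Anc H v c

/-- `z` is the lowest common ancestor of `x` and `y`. -/
def IsLCA (H : SimpleGraph W) (z x y : W) : Prop :=
  Anc H z x ∧ Anc H z y ∧ ∀ z', Anc H z' x → Anc H z' y → Anc H z' z

/-- The lowest common ancestor of two vertices of the same tree. -/
def lca (H : SimpleGraph W) (x y : W) : W := @Classical.epsilon W ⟨x⟩ (fun z => IsLCA H z x y)

/-- The vertex set of the subtree of `T` that hangs at `v`. -/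
def desc (H : SimpleGraph W) (T : Finset W) (v : W) : Finset W :=
  open Classical in T.filter (fun x => Anc H v x)

/-- `v` is the splitting vertex of `T`: its subtree has more than half of the vertices
of `T`, the subtree of each of its children has at most half of them. -/
def IsSplit (H : SimpleGraph W) (T : Finset W) (v : W) : Prop :=
  v ∈ T ∧ T.card < 2 * (desc H T v).card ∧
    ∀ c ∈ T, IsChild H v c → 2 * (desc H T c).card ≤ T.card

/-- The splitting vertex of `T` (it exists and is unique for a nonempty subtree; `r` only serves
as a default value). -/
def splitVertex (H : SimpleGraph W) (T : Finset W) (r : W) : W :=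
  @Classical.epsilon W ⟨r⟩ (fun v => IsSplit H T v)

/-- `rootedDist H w X fuel T r x` is the noisy distance from `r` to `x` in the subtree of `H`
with vertex set `T` and top vertex `r`. Let `v` be the splitting vertex of `T`. The noisy
distance to `v` is `d(r, v) + X (T, v)`, and for each child `c ∈ T` of `v` the noisy distance to
`c` is the one to `v` plus `w (v, c) + X (T, c)`. If `x` lies in the subtree of a child `c`,
recurse into this subtree (with root `c`) and add the noisy distance to `c`; otherwise recurse into
`T` without the subtrees of the children (with root `r`). The argument `fuel` bounds the depth of
the recursion; as `T` shrinks strictly, any value `≥ |T|` gives the same result. -/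
def rootedDist (H : SimpleGraph W) (w : Sym2 W → ℝ≥0) (X : Finset W × W → ℝ) :
    ℕ → Finset W → W → W → ℝ
  | 0, _, _, _ => 0
  | fuel + 1, T, r, x =>
    open Classical in
    if T.card ≤ 1 then 0
    else
      let v := splitVertex H T r
      if h : ∃ c ∈ T, IsChild H v c ∧ Anc H c x then
        let c := h.choose
        wdist H w r v + X (T, v) + (w s(v, c) + X (T, c))
          + rootedDist H w X fuel (desc H T c) c x
      else
        rootedDist H w X fuel
          (T.filter (fun y => ¬ ∃ c ∈ T, IsChild H v c ∧ Anc H c y)) r x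

/-- The noisy distance from the root of the tree of `x` to `x`. -/
def rootDist (H : SimpleGraph W) (w : Sym2 W → ℝ≥0) (X : Finset W × W → ℝ) (x : W) : ℝ :=
  open Classical in
  rootedDist H w X (Fintype.card W) (Finset.univ.filter (fun y => H.Reachable x y)) (root H x) x

/-- The noisy distance between two vertices of a forest, `⊤` in different trees. -/
def forestDist (H : SimpleGraph W) (w : Sym2 W → ℝ≥0) (X : Finset W × W → ℝ) (x y : W) : EReal :=
  open Classical in
  if H.Reachable x y then
    ((rootDist H w X x + rootDist H w X y - 2 * rootDist H w X (lca H x y) : ℝ) : EReal)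
  else ⊤

/-- The noise of the forest mechanism with privacy parameter `ε`: independent Laplace variables
of scale `⌈log₂ |W|⌉ / ε`. -/
def forestNoise (W : Type u) [Fintype W] (ε : ℝ) : Measure (Finset W × W → ℝ) :=
  Measure.pi (fun _ => laplace ((Nat.clog 2 (Fintype.card W) : ℝ) / ε))

end Forest

/-! ### The release algorithm for a graph with feedback vertex set `S` -/

section Algorithm

variable {V : Type u} [Fintype V] [DecidableEq V]

/-- The noise used by the algorithm: for the forest `G ∖ S`, for the ordered pairs of vertices of
`S`, and for the edges between `S` and `V ∖ S`. -/
abbrev Noise (S : Finset V) : Type u :=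
  (Finset {v // v ∉ S} × {v // v ∉ S} → ℝ) × (V × V → ℝ) × (Sym2 V → ℝ)

/-- All noise variables are independent. With `ε' = ε / 3` and `k = |S|`: the forest mechanism has
privacy parameter `ε'`, the pairs in `S` have scale `2 √2 k √(log (1 / δ)) / ε'`, and the edges
between `S` and `V ∖ S` have scale `1 / ε'`. -/
def noiseLaw (S : Finset V) (ε δ : ℝ) : Measure (Noise S) :=
  (forestNoise {v // v ∉ S} (ε / 3)).prod
    ((Measure.pi (fun _ : V × V =>
        laplace (2 * √2 * (S.card : ℝ) * √(Real.log (1 / δ)) / (ε / 3)))).prod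
      (Measure.pi (fun _ : Sym2 V => laplace (1 / (ε / 3)))))

variable (G : SimpleGraph V) (S : Finset V) (w : Sym2 V → ℝ≥0) (X : Noise S)

/-- Noisy distances in the forest `G ∖ S`. -/
def treeStep (u v : {v // v ∉ S}) : EReal :=
  forestDist (G.induce {v | v ∉ S}) (fun e => w (e.map Subtype.val)) X.1 u v

/-- Noisy distances in `G` between two vertices of `S`. -/
def innerStep (u v : V) : ℝ := wdist G w u v + X.2.1 (u, v)

/-- Noisy weight of an edge between `S` and `V ∖ S`. -/
def noisyWeight (p v : V) : ℝ := (w s(p, v) : ℝ) + X.2.2 s(p, v)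

/-- Paths from `u ∉ S` to `v ∈ S` with no further vertex in `S`: minimum over the neighbours
`p ∉ S` of `v`. -/
def lastStep (u : {v // v ∉ S}) (v : V) : EReal :=
  ⨅ p : {p : {v // v ∉ S} // G.Adj p v},
    treeStep G S w X u p + (noisyWeight S w X p v : EReal)

/-- Paths from `u ∉ S` to `v ∈ S` through a first vertex `p ∈ S`. -/
def crossStep (u : {v // v ∉ S}) (v : V) : EReal :=
  ⨅ p : {p // p ∈ S}, lastStep G S w X u p + (innerStep G S w X p v : EReal)

/-- Pairs `u, v ∉ S`: the better of the forest distance and of the connections through a vertex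
of `S`. -/
def outerStep (u v : {v // v ∉ S}) : EReal :=
  min (treeStep G S w X u v) (⨅ p : {p // p ∈ S}, crossStep G S w X u p + crossStep G S w X v p)

/-- The distances released on weights `w` and noise `X`. -/
def releasedDist (u v : V) : EReal :=
  if hu : u ∈ S then
    if hv : v ∈ S then (innerStep G S w X u v : EReal) else crossStep G S w X ⟨v, hv⟩ u
  else
    if hv : v ∈ S then crossStep G S w X ⟨u, hu⟩ v else outerStep G S w X ⟨u, hu⟩ ⟨v, hv⟩

/-- The output law of the algorithm with privacy parameters `ε, δ` on weights `w`. -/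
def releaseLaw (ε δ : ℝ) : Measure (V → V → EReal) :=
  (noiseLaw S ε δ).map (fun X => releasedDist G S w X)

end Algorithm

end

end FVSRelease

/-! Privacy. The weights enter the algorithm only through quantities that each carry their own noise
variable. Running it on `w` with noise `X` therefore equals running it on weight zero with noise `X
+ trueValues G S w` (`releasedDist_eq`), and the output law is the image, under one fixed measurable
map, of a product of three shifted Laplace vectors (`releaseLaw_eq`). It remains to compare these
vectors for neighbouring weights, with budget `ε / 3` each. The forest vector has ℓ¹-sensitivity at
most `⌈log₂ N⌉` (`sum_abs_forestValue_sub_le`): one split uses every edge of the current subtree at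
most once, the pieces are disjoint, and splitting lowers `⌈log₂⌉` of the size by at least one. The
edge vector has ℓ¹-sensitivity at most 1. The distances inside `S` are `k²` queries of sensitivity
at most 1; there the privacy loss is a sum of independent bounded variables with small mean, so a
subgaussian tail bound (`indist_laplacePi_of_card`) permits a scale linear in `k`, at the price of
`δ`. This is the only one of the three vectors that uses `δ`.

Accuracy. A noisy root distance is the true one plus at most `2 ⌈log₂ N⌉` noise variables
(`rootDist_eq`, `card_rootNoiseIndices_le`). Exponential moments and union bounds give, with
probability at least `1 - 3 * γ`, the event `SmallNoise` (`measure_smallNoise_ge`). On it the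
argument is deterministic (`releasedDist_mem`): every candidate in a minimum is at least the true
distance up to noise, by the triangle inequality, and a shortest path, cut at its first vertex in
`S` (`walk_cases`), supplies a candidate that is nearly optimal. The tail bounds give `log² n` in
the forest term; this is absorbed into `log^{5/2} n`. -/

namespace FVSRelease

/-! ### Rooted forests -/

section RootedForest

open SimpleGraph

variable {W : Type u} {H : SimpleGraph W}

lemma reachable_root (H : SimpleGraph W) (x : W) : H.Reachable (root H x) x :=
  ConnectedComponent.exact (Quot.out_eq (H.connectedComponentMk x))

lemma root_eq_of_reachable {x y : W} (h : H.Reachable x y) : root H x = root H y := by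
  unfold root; rw [ConnectedComponent.sound h]

lemma root_root (H : SimpleGraph W) (x : W) : root H (root H x) = root H x :=
  root_eq_of_reachable (reachable_root H x)

/-- The path from the root to `x`. -/
noncomputable def rootPath (H : SimpleGraph W) (x : W) : H.Path (root H x) x :=
  open Classical in (reachable_root H x).some.toPath

/-- The vertices on the path from the root to `x`. -/
noncomputable def lineage (H : SimpleGraph W) (x : W) : List W := (rootPath H x).1.support

lemma nodup_lineage (x : W) : (lineage H x).Nodup := (rootPath H x).2.support_nodup

lemma isPath_unique (hH : H.IsAcyclic) {u v : W} {p q : H.Walk u v} (hp : p.IsPath)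
    (hq : q.IsPath) : p = q :=
  congrArg Subtype.val ((hH.subsingleton_path u v).elim ⟨p, hp⟩ ⟨q, hq⟩)

/-- Every walk contains the support of a path, and in a forest that path is unique, so the
quantifier over walks can be tested on one path. -/
lemma anc_iff_mem_lineage (hH : H.IsAcyclic) {v x : W} : Anc H v x ↔ v ∈ lineage H x := by
  classical
  refine ⟨fun h => h _, fun h p => ?_⟩
  have : (rootPath H x).1 = p.toPath.1 := isPath_unique hH (rootPath H x).2 p.toPath.2
  rw [lineage, this] at h
  exact p.support_toPath_subset_support h

lemma support_eq_lineage (hH : H.IsAcyclic) {ρ x : W} (hρ : ρ = root H x) (p : H.Walk ρ x)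
    (hp : p.IsPath) : p.support = lineage H x := by
  subst hρ
  rw [isPath_unique hH hp (rootPath H x).2, lineage]

lemma Anc.reachable (hH : H.IsAcyclic) {v x : W} (h : Anc H v x) : H.Reachable v x := by
  classical
  rw [anc_iff_mem_lineage hH] at h
  exact ⟨(rootPath H x).1.dropUntil v h⟩

lemma Anc.lineage_prefix (hH : H.IsAcyclic) {v x : W} (h : Anc H v x) :
    lineage H v <+: lineage H x := by
  classical
  have hr := root_eq_of_reachable (h.reachable hH)
  rw [anc_iff_mem_lineage hH] at h
  rw [← support_eq_lineage hH hr.symm ((rootPath H x).1.takeUntil v h)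
    ((rootPath H x).2.takeUntil h)]
  exact (rootPath H x).1.support_takeUntil_prefix_support h

lemma getLast?_lineage (x : W) : (lineage H x).getLast? = some x := by
  rw [lineage, List.getLast?_eq_some_getLast (by simp)]; simp

lemma eq_of_lineage_eq {x y : W} (h : lineage H x = lineage H y) : x = y := by
  have := getLast?_lineage (H := H) x
  rw [h, getLast?_lineage] at this
  simpa using this.symm

lemma Anc.refl (H : SimpleGraph W) (x : W) : Anc H x x := fun p => p.end_mem_support

/-- Turns ancestry into the prefix order on lists, from which transitivity, antisymmetry and
comparability of two ancestors of one vertex are inherited. -/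
lemma anc_iff_prefix (hH : H.IsAcyclic) {v x : W} : Anc H v x ↔ lineage H v <+: lineage H x :=
  ⟨fun h => h.lineage_prefix hH, fun h => (anc_iff_mem_lineage hH).2
    (h.subset ((anc_iff_mem_lineage hH).1 (Anc.refl H v)))⟩

lemma Anc.trans (hH : H.IsAcyclic) {u v x : W} (h : Anc H u v) (h' : Anc H v x) : Anc H u x := by
  rw [anc_iff_prefix hH] at *
  exact h.trans h'

lemma Anc.antisymm (hH : H.IsAcyclic) {u v : W} (h : Anc H u v) (h' : Anc H v u) : u = v := by
  rw [anc_iff_prefix hH] at *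
  exact eq_of_lineage_eq (h.eq_of_length_le h'.length_le)

lemma Anc.total (hH : H.IsAcyclic) {u v x : W} (h : Anc H u x) (h' : Anc H v x) :
    Anc H u v ∨ Anc H v u := by
  simp only [anc_iff_prefix hH] at *
  exact List.prefix_or_prefix_of_prefix h h'

lemma root_anc (H : SimpleGraph W) (x : W) : Anc H (root H x) x := fun p => p.start_mem_support

lemma IsChild.lineage_eq (hH : H.IsAcyclic) {v c : W} (h : IsChild H v c) :
    lineage H c = lineage H v ++ [c] := by
  have hc : c ∉ (rootPath H v).1.support := fun hc =>
    h.1.ne (h.2.antisymm hH ((anc_iff_mem_lineage hH).2 hc))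
  rw [← support_eq_lineage hH (root_eq_of_reachable h.1.reachable)
    ((rootPath H v).1.concat h.1) ((rootPath H v).2.concat hc h.1), Walk.support_concat, lineage]

lemma IsChild.eq_or_eq_of_anc (hH : H.IsAcyclic) {v c y : W} (h : IsChild H v c)
    (h₂ : Anc H y c) : Anc H y v ∨ y = c := by
  rw [anc_iff_mem_lineage hH, h.lineage_eq hH, List.mem_append, List.mem_singleton,
    ← anc_iff_mem_lineage hH] at h₂
  exact h₂

lemma IsChild.not_anc (hH : H.IsAcyclic) {v c : W} (h : IsChild H v c) : ¬ Anc H c v :=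
  fun h' => h.1.ne (h.2.antisymm hH h')

/-- Two ancestors of `x` are comparable, and nothing lies strictly between a vertex and its child.
Hence subtrees of different children are disjoint. -/
lemma IsChild.eq_of_anc (hH : H.IsAcyclic) {v c c' x : W} (h : IsChild H v c)
    (h' : IsChild H v c') (hx : Anc H c x) (hx' : Anc H c' x) : c = c' := by
  rcases hx.total hH hx' with h₁ | h₁
  · exact (h'.eq_or_eq_of_anc hH h₁).resolve_left (h.not_anc hH)
  · exact ((h.eq_or_eq_of_anc hH h₁).resolve_left (h'.not_anc hH)).symm

/-- On a path that descends from `r` to `x` there are exactly the vertices between the two. -/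
lemma mem_support_iff_of_anc (hH : H.IsAcyclic) {r x : W} (hr : Anc H r x) (q : H.Walk r x)
    (hq : q.IsPath) (y : W) : y ∈ q.support ↔ Anc H r y ∧ Anc H y x := by
  classical
  have hr' := (anc_iff_mem_lineage hH).1 hr
  have hρ := root_eq_of_reachable (hr.reachable hH)
  have hP := (rootPath H x).2
  have hPr := hP.takeUntil hr'
  have hqe : q = (rootPath H x).1.dropUntil r hr' := isPath_unique hH hq (hP.dropUntil hr')
  have hspec := (rootPath H x).1.take_spec hr'
  rw [← hqe] at hspec
  set A := (rootPath H x).1.takeUntil r hr'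
  have hA : A.support = lineage H r := support_eq_lineage hH hρ.symm A hPr
  have hL : lineage H x = A.support ++ q.support.tail := by
    rw [lineage, ← hspec, Walk.support_append]
  have hnd := nodup_lineage (H := H) x
  rw [hL, List.nodup_append] at hnd
  have hqs : q.support = r :: q.support.tail := q.cons_tail_support.symm
  constructor
  · intro hy
    have hyx : Anc H y x := by
      rw [hqs, List.mem_cons] at hy
      rcases hy with rfl | hy
      · exact hr
      · rw [anc_iff_mem_lineage hH, hL, List.mem_append]
        exact Or.inr hy
    refine ⟨?_, hyx⟩
    rcases hr.total hH hyx with h | h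
    · exact h
    · rw [anc_iff_mem_lineage hH, ← hA] at h
      rw [hqs, List.mem_cons] at hy
      rcases hy with rfl | hy
      · exact Anc.refl _ _
      · exact absurd rfl (hnd.2.2 y h y hy)
  · rintro ⟨h₁, h₂⟩
    rw [anc_iff_mem_lineage hH, hL, List.mem_append, hA, ← anc_iff_mem_lineage hH] at h₂
    rcases h₂ with h₂ | h₂
    · rw [h₂.antisymm hH h₁]; exact q.start_mem_support
    · exact List.mem_of_mem_tail h₂

lemma exists_child_anc (hH : H.IsAcyclic) {v x : W} (h : Anc H v x) (hne : v ≠ x) :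
    ∃ c, IsChild H v c ∧ Anc H c x := by
  classical
  have q := (h.reachable hH).some.toPath
  obtain ⟨q, hq⟩ := q
  cases q with
  | nil => exact absurd rfl hne
  | cons hadj q =>
    rename_i c
    have hc := (mem_support_iff_of_anc hH h _ hq c).1 (by simp)
    exact ⟨c, ⟨hadj, hc.1⟩, hc.2⟩

/-! ### Weighted distances in a forest -/

lemma wdist_eq_of_isPath (hH : H.IsAcyclic) (w : Sym2 W → ℝ≥0) {u v : W} (p : H.Walk u v)
    (hp : p.IsPath) : wdist H w u v = (p.edges.map (fun e => (w e : ℝ))).sum := by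
  have : Unique (H.Path u v) := ⟨⟨⟨p, hp⟩⟩, fun q => (hH.subsingleton_path u v).elim _ _⟩
  rw [wdist, ciInf_unique]
  exact congrArg (fun q : H.Walk u v => (q.edges.map (fun e => (w e : ℝ))).sum)
    (isPath_unique hH (Subtype.prop _) hp)

lemma wdist_self_of_isAcyclic (hH : H.IsAcyclic) (w : Sym2 W → ℝ≥0) (u : W) :
    wdist H w u u = 0 := by
  rw [wdist_eq_of_isPath hH w Walk.nil Walk.IsPath.nil]; simp

lemma wdist_of_adj (hH : H.IsAcyclic) (w : Sym2 W → ℝ≥0) {u v : W} (h : H.Adj u v) :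
    wdist H w u v = w s(u, v) := by
  rw [wdist_eq_of_isPath hH w h.toWalk h.isPath_toWalk]; simp

lemma wdist_add_of_anc (hH : H.IsAcyclic) (w : Sym2 W → ℝ≥0) {r v x : W} (h : Anc H r v)
    (h' : Anc H v x) : wdist H w r x = wdist H w r v + wdist H w v x := by
  classical
  obtain ⟨q, hq⟩ := ((h.trans hH h').reachable hH).some.toPath
  have hv := (mem_support_iff_of_anc hH (h.trans hH h') q hq v).2 ⟨h, h'⟩
  rw [wdist_eq_of_isPath hH w q hq, wdist_eq_of_isPath hH w _ (hq.takeUntil hv),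
    wdist_eq_of_isPath hH w _ (hq.dropUntil hv)]
  conv_lhs => rw [← q.take_spec hv, Walk.edges_append, List.map_append, List.sum_append]

/-- A common ancestor of maximal depth works, because all ancestors of `x` are comparable; the root
shows that there is one. -/
lemma exists_isLCA (hH : H.IsAcyclic) {x y : W} (h : H.Reachable x y) : ∃ z, IsLCA H z x y := by
  classical
  let s := (lineage H x).toFinset.filter (fun z => Anc H z y)
  have hs : s.Nonempty := ⟨root H x, by
    rw [Finset.mem_filter, List.mem_toFinset, ← anc_iff_mem_lineage hH]
    refine ⟨root_anc H x, ?_⟩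
    rw [root_eq_of_reachable h]
    exact root_anc H y⟩
  obtain ⟨z, hz, hmax⟩ := s.exists_max_image (fun z => (lineage H z).length) hs
  simp only [s, Finset.mem_filter, List.mem_toFinset, ← anc_iff_mem_lineage hH] at hz hmax
  refine ⟨z, hz.1, hz.2, fun z' h₁ h₂ => ?_⟩
  rcases h₁.total hH hz.1 with h₃ | h₃
  · exact h₃
  · have := (anc_iff_prefix hH).1 h₃
    rw [eq_of_lineage_eq (this.eq_of_length_le (hmax z' ⟨h₁, h₂⟩))]
    exact Anc.refl _ _

lemma isLCA_lca (hH : H.IsAcyclic) {x y : W} (h : H.Reachable x y) : IsLCA H (lca H x y) x y := by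
  unfold lca
  exact Classical.epsilon_spec (exists_isLCA hH h)

/-- The descending paths from `z` to `x` and to `y` meet only in `z`, so joined together they are
the path from `x` to `y`. -/
lemma wdist_eq_of_isLCA (hH : H.IsAcyclic) (w : Sym2 W → ℝ≥0) {x y z : W} (h : IsLCA H z x y) :
    wdist H w x y = wdist H w (root H x) x + wdist H w (root H y) y
      - 2 * wdist H w (root H z) z := by
  classical
  obtain ⟨hx, hy, hz⟩ := h
  obtain ⟨p, hp⟩ := (hx.reachable hH).some.toPath
  obtain ⟨q, hq⟩ := (hy.reachable hH).some.toPath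
  have hpath : (p.reverse.append q).IsPath := by
    rw [Walk.isPath_def, Walk.support_append, List.nodup_append]
    refine ⟨hp.reverse.support_nodup, hq.support_nodup.tail, ?_⟩
    rintro a ha b hb rfl
    rw [Walk.support_reverse, List.mem_reverse, mem_support_iff_of_anc hH hx p hp] at ha
    have hb' := (mem_support_iff_of_anc hH hy q hq a).1 (List.mem_of_mem_tail hb)
    have := (hz a ha.2 hb'.2).antisymm hH ha.1
    have hnd := hq.support_nodup
    rw [← q.cons_tail_support, List.nodup_cons] at hnd
    exact hnd.1 (this ▸ hb)
  rw [wdist_eq_of_isPath hH w _ hpath, Walk.edges_append, List.map_append, List.sum_append,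
    Walk.edges_reverse, List.map_reverse, List.sum_reverse, ← wdist_eq_of_isPath hH w p hp,
    ← wdist_eq_of_isPath hH w q hq]
  have h₁ := wdist_add_of_anc hH w (root_anc H z) hx
  have h₂ := wdist_add_of_anc hH w (root_anc H z) hy
  rw [← root_eq_of_reachable (hx.reachable hH), ← root_eq_of_reachable (hy.reachable hH)]
  linarith

end RootedForest

end FVSRelease

namespace FVSRelease

/-! ### The recursive decomposition of a rooted tree -/

section Decomposition

open SimpleGraph

variable {W : Type u} {H : SimpleGraph W}

/-- `T` is a subtree of the rooted forest `H` with top vertex `r`. -/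
structure IsTop (H : SimpleGraph W) (T : Finset W) (r : W) : Prop where
  mem : r ∈ T
  anc : ∀ x ∈ T, Anc H r x
  between : ∀ x ∈ T, ∀ y, Anc H r y → Anc H y x → y ∈ T

/-- The part of `T` that remains when the subtrees of the children of `v` are removed. -/
noncomputable def trunk (H : SimpleGraph W) (T : Finset W) (v : W) : Finset W :=
  open Classical in T.filter (fun y => ¬ ∃ c ∈ T, IsChild H v c ∧ Anc H c y)

lemma mem_desc {T : Finset W} {v x : W} : x ∈ desc H T v ↔ x ∈ T ∧ Anc H v x := by
  simp [desc]

lemma mem_trunk {T : Finset W} {v x : W} :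
    x ∈ trunk H T v ↔ x ∈ T ∧ ¬ ∃ c ∈ T, IsChild H v c ∧ Anc H c x := by
  simp [trunk]

lemma desc_subset (H : SimpleGraph W) (T : Finset W) (v : W) : desc H T v ⊆ T :=
  fun _ h => (mem_desc.1 h).1

lemma trunk_subset (H : SimpleGraph W) (T : Finset W) (v : W) : trunk H T v ⊆ T :=
  fun _ h => (mem_trunk.1 h).1

namespace IsTop

variable {T : Finset W} {r v : W}

lemma unique (hH : H.IsAcyclic) {r' : W} (h : IsTop H T r) (h' : IsTop H T r') : r = r' :=
  (h.anc _ h'.mem).antisymm hH (h'.anc _ h.mem)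

lemma desc (hH : H.IsAcyclic) (h : IsTop H T r) (hv : v ∈ T) : IsTop H (desc H T v) v where
  mem := mem_desc.2 ⟨hv, Anc.refl _ _⟩
  anc _ hx := (mem_desc.1 hx).2
  between x hx y h₁ h₂ :=
    mem_desc.2 ⟨h.between x (mem_desc.1 hx).1 y ((h.anc v hv).trans hH h₁) h₂, h₁⟩

lemma trunk (hH : H.IsAcyclic) (h : IsTop H T r) (hv : v ∈ T) : IsTop H (trunk H T v) r where
  mem := by
    refine mem_trunk.2 ⟨h.mem, ?_⟩
    rintro ⟨c, hc, hvc, hcr⟩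
    exact hvc.not_anc hH (hcr.trans hH (h.anc v hv))
  anc x hx := h.anc x (mem_trunk.1 hx).1
  between x hx y h₁ h₂ := by
    rw [mem_trunk] at hx ⊢
    refine ⟨h.between x hx.1 y h₁ h₂, ?_⟩
    rintro ⟨c, hc, hvc, hcy⟩
    exact hx.2 ⟨c, hc, hvc, hcy.trans hH h₂⟩

/-- Among the vertices whose subtree exceeds half of `T`, take one with the smallest subtree; the
subtree of a child is strictly smaller. -/
lemma exists_isSplit (hH : H.IsAcyclic) (h : IsTop H T r) : ∃ v, IsSplit H T v := by
  classical
  have hr : FVSRelease.desc H T r = T :=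
    Finset.Subset.antisymm (desc_subset _ _ _) fun x hx => mem_desc.2 ⟨hx, h.anc x hx⟩
  have hpos : 0 < T.card := Finset.card_pos.2 ⟨r, h.mem⟩
  let s := T.filter fun v => T.card < 2 * (FVSRelease.desc H T v).card
  have hs : s.Nonempty := ⟨r, Finset.mem_filter.2 ⟨h.mem, by rw [hr]; omega⟩⟩
  obtain ⟨v, hv, hmin⟩ := s.exists_min_image (fun v => (FVSRelease.desc H T v).card) hs
  simp only [s, Finset.mem_filter] at hv hmin
  refine ⟨v, hv.1, hv.2, fun c hc hvc => ?_⟩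
  by_contra hlt
  refine absurd (hmin c ⟨hc, not_le.1 hlt⟩) (not_le.2 (Finset.card_lt_card ?_))
  refine Finset.ssubset_iff_of_subset (fun x hx => ?_) |>.2 ⟨v, mem_desc.2 ⟨hv.1, Anc.refl _ _⟩, ?_⟩
  · rw [mem_desc] at hx ⊢
    exact ⟨hx.1, hvc.2.trans hH hx.2⟩
  · exact fun hx => hvc.not_anc hH (mem_desc.1 hx).2

lemma isSplit_splitVertex (hH : H.IsAcyclic) (h : IsTop H T r) (r' : W) :
    IsSplit H T (splitVertex H T r') :=
  Classical.epsilon_spec (h.exists_isSplit hH)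

/-- Removing the subtrees of the children leaves fewer than half of the vertices outside the subtree
of `v`, plus `v` itself, which accounts for the `+ 1`. -/
lemma card_trunk_le (hH : H.IsAcyclic) (h : IsTop H T r) (hv : IsSplit H T v) :
    2 * (FVSRelease.trunk H T v).card ≤ T.card + 1 := by
  classical
  have hsub : FVSRelease.trunk H T v ⊆ insert v (T \ FVSRelease.desc H T v) := by
    intro y hy
    rw [mem_trunk] at hy
    rw [Finset.mem_insert, Finset.mem_sdiff, mem_desc]
    by_cases hvy : Anc H v y
    · left
      by_contra hne
      obtain ⟨c, hc, hcy⟩ := exists_child_anc hH hvy (Ne.symm hne)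
      exact hy.2 ⟨c, h.between y hy.1 c ((h.anc v hv.1).trans hH hc.2) hcy, hc, hcy⟩
    · exact Or.inr ⟨hy.1, fun h => hvy h.2⟩
  have h₁ := Finset.card_le_card hsub
  have h₂ := Finset.card_insert_le v (T \ FVSRelease.desc H T v)
  have h₃ := Finset.card_sdiff_add_card_eq_card (desc_subset H T v)
  have h₄ := hv.2.1
  omega

end IsTop

/-- The slack `n + 1` left by the trunk is harmless: `Nat.clog` halves with rounding up. -/
lemma clog_add_one_le {m n : ℕ} (hn : 2 ≤ n) (hm : 2 * m ≤ n + 1) :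
    Nat.clog 2 m + 1 ≤ Nat.clog 2 n := by
  rw [Nat.clog_of_two_le one_lt_two hn]
  exact Nat.succ_le_succ (Nat.clog_mono_right 2 (by omega))

/-! ### Which noise variables enter a rooted distance -/

section NoiseIndices

variable [DecidableEq W]

/-- The indices of the noise variables that enter the noisy distance from `r` to `x` in `T`. -/
noncomputable def noiseIndices (H : SimpleGraph W) :
    ℕ → Finset W → W → W → Finset (Finset W × W)
  | 0, _, _, _ => ∅
  | fuel + 1, T, r, x =>
    open Classical in
    if T.card ≤ 1 then ∅
    else
      let v := splitVertex H T r
      if h : ∃ c ∈ T, IsChild H v c ∧ Anc H c x then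
        {(T, v), (T, h.choose)} ∪ noiseIndices H fuel (desc H T h.choose) h.choose x
      else noiseIndices H fuel (trunk H T v) r x

lemma noiseIndices_subset (fuel : ℕ) (T : Finset W) (r x : W) :
    ∀ j ∈ noiseIndices H fuel T r x, j.1 ⊆ T := by
  induction fuel generalizing T r with
  | zero => simp [noiseIndices]
  | succ fuel ih =>
    intro j hj
    rw [noiseIndices] at hj
    dsimp only at hj
    split_ifs at hj with h₁ h₂
    · simp at hj
    · simp only [Finset.mem_union, Finset.mem_insert, Finset.mem_singleton] at hj
      rcases hj with (rfl | rfl) | hj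
      · exact subset_rfl
      · exact subset_rfl
      · exact (ih _ _ j hj).trans (desc_subset _ _ _)
    · exact (ih _ _ j hj).trans (trunk_subset _ _ _)

/-- Descending to a child uses two variables, staying in the trunk none; either way `Nat.clog 2
T.card` drops by at least one. -/
lemma card_noiseIndices_le (hH : H.IsAcyclic) (fuel : ℕ) {T : Finset W} {r : W}
    (hT : IsTop H T r) (x : W) :
    (noiseIndices H fuel T r x).card ≤ 2 * Nat.clog 2 T.card := by
  induction fuel generalizing T r with
  | zero => simp [noiseIndices]
  | succ fuel ih =>
    rw [noiseIndices]
    have hs := hT.isSplit_splitVertex hH r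
    dsimp only
    split_ifs with h₁ h₂
    · simp
    · obtain ⟨hc, hvc, -⟩ := h₂.choose_spec
      have h₃ := ih (hT.desc hH hc)
      have h₄ := clog_add_one_le (not_le.1 h₁) ((hs.2.2 _ hc hvc).trans (Nat.le_succ _))
      have h₅ := Finset.card_union_le {(T, splitVertex H T r), (T, h₂.choose)}
        (noiseIndices H fuel (desc H T h₂.choose) h₂.choose x)
      have h₆ := Finset.card_le_two (a := (T, splitVertex H T r)) (b := (T, h₂.choose))
      omega
    · have h₃ := ih (hT.trunk hH hs.1)
      have h₄ := clog_add_one_le (not_le.1 h₁) (hT.card_trunk_le hH hs)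
      omega

lemma rootedDist_eq (hH : H.IsAcyclic) (w : Sym2 W → ℝ≥0) (X : Finset W × W → ℝ) (fuel : ℕ)
    {T : Finset W} {r x : W} (hT : IsTop H T r) (hx : x ∈ T) (hf : T.card ≤ fuel) :
    rootedDist H w X fuel T r x = wdist H w r x + ∑ j ∈ noiseIndices H fuel T r x, X j := by
  induction fuel generalizing T r with
  | zero => rw [Nat.le_zero, Finset.card_eq_zero] at hf; simp [hf] at hx
  | succ fuel ih =>
    rw [rootedDist, noiseIndices]
    have hs := hT.isSplit_splitVertex hH r
    dsimp only
    split_ifs with h₁ h₂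
    · rw [Finset.card_le_one.1 h₁ x hx r hT.mem, wdist_self_of_isAcyclic hH]
      simp
    · obtain ⟨hc, hvc, hcx⟩ := h₂.choose_spec
      have hcard := hs.2.2 _ hc hvc
      rw [ih (hT.desc hH hc) (mem_desc.2 ⟨hx, hcx⟩) (by omega), Finset.sum_union,
        Finset.sum_pair, wdist_add_of_anc hH w (hT.anc _ hs.1) (hvc.2.trans hH hcx),
        wdist_add_of_anc hH w hvc.2 hcx, wdist_of_adj hH w hvc.1]
      · ring
      · intro h
        exact hvc.1.ne (Prod.ext_iff.1 h).2
      · rw [Finset.disjoint_left]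
        intro j hj hj'
        have hsub := Finset.card_le_card (noiseIndices_subset fuel _ _ x j hj')
        have : j.1 = T := by
          rw [Finset.mem_insert, Finset.mem_singleton] at hj
          rcases hj with rfl | rfl <;> rfl
        rw [this] at hsub
        omega
    · have hcard := hT.card_trunk_le hH hs
      exact ih (hT.trunk hH hs.1) (mem_trunk.2 ⟨hx, h₂⟩) (by change (trunk H T _).card ≤ _; omega)

end NoiseIndices

/-! ### Passing from subtrees to the trees of the forest -/

section Component

variable [Fintype W]

/-- The vertices of the tree of `x`. -/
noncomputable def treeOf (H : SimpleGraph W) (x : W) : Finset W :=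
  open Classical in Finset.univ.filter (fun y => H.Reachable x y)

lemma mem_treeOf {x y : W} : y ∈ treeOf H x ↔ H.Reachable x y := by simp [treeOf]

lemma treeOf_root (H : SimpleGraph W) (x : W) : treeOf H (root H x) = treeOf H x := by
  ext y
  rw [mem_treeOf, mem_treeOf]
  exact ⟨(reachable_root H x).symm.trans, (reachable_root H x).trans⟩

lemma isTop_treeOf (hH : H.IsAcyclic) (x : W) : IsTop H (treeOf H x) (root H x) where
  mem := mem_treeOf.2 (reachable_root H x).symm
  anc y hy := by
    rw [root_eq_of_reachable (mem_treeOf.1 hy)]; exact root_anc H y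
  between y hy z _ h := mem_treeOf.2 ((mem_treeOf.1 hy).trans (h.reachable hH).symm)

variable [DecidableEq W]

/-- The indices of the noise variables that enter the noisy distance from the root to `x`. -/
noncomputable def rootNoiseIndices (H : SimpleGraph W) (x : W) : Finset (Finset W × W) :=
  noiseIndices H (Fintype.card W) (treeOf H x) (root H x) x

lemma card_rootNoiseIndices_le (hH : H.IsAcyclic) (x : W) :
    (rootNoiseIndices H x).card ≤ 2 * Nat.clog 2 (Fintype.card W) :=
  (card_noiseIndices_le hH _ (isTop_treeOf hH x) x).trans
    (Nat.mul_le_mul_left 2 (Nat.clog_mono_right 2 (Finset.card_le_univ _)))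

lemma rootDist_eq (hH : H.IsAcyclic) (w : Sym2 W → ℝ≥0) (X : Finset W × W → ℝ) (x : W) :
    rootDist H w X x = wdist H w (root H x) x + ∑ j ∈ rootNoiseIndices H x, X j := by
  rw [rootNoiseIndices, ← rootedDist_eq hH w X _ (isTop_treeOf hH x)
    (mem_treeOf.2 (Reachable.refl x)) (Finset.card_le_univ _)]
  unfold rootDist treeOf
  congr!

lemma forestDist_of_reachable (hH : H.IsAcyclic) (w : Sym2 W → ℝ≥0) (X : Finset W × W → ℝ)
    {x y : W} (h : H.Reachable x y) :
    forestDist H w X x y = ((wdist H w x y + (∑ j ∈ rootNoiseIndices H x, X j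
      + ∑ j ∈ rootNoiseIndices H y, X j - 2 * ∑ j ∈ rootNoiseIndices H (lca H x y), X j) : ℝ)
        : EReal) := by
  rw [forestDist, if_pos h, rootDist_eq hH, rootDist_eq hH, rootDist_eq hH,
    wdist_eq_of_isLCA hH w (isLCA_lca hH h)]
  congr 1
  ring

lemma forestDist_of_not_reachable (w : Sym2 W → ℝ≥0) (X : Finset W × W → ℝ)
    {x y : W} (h : ¬ H.Reachable x y) : forestDist H w X x y = ⊤ := if_neg h

end Component

end Decomposition

end FVSRelease

namespace FVSRelease

/-! ### Sensitivity of the forest mechanism -/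

section Sensitivity

open SimpleGraph

variable {W : Type u} {H : SimpleGraph W}

lemma abs_sum_edges_sub_le [DecidableEq W] (w w' : Sym2 W → ℝ≥0) {u v : W} (p : H.Walk u v)
    (hp : p.IsPath) :
    |(p.edges.map (fun e => (w e : ℝ))).sum - (p.edges.map (fun e => (w' e : ℝ))).sum|
      ≤ ∑ e ∈ p.edges.toFinset, |(w e : ℝ) - w' e| := by
  rw [← List.sum_toFinset _ hp.isTrail.edges_nodup, ← List.sum_toFinset _ hp.isTrail.edges_nodup,
    ← Finset.sum_sub_distrib]
  exact Finset.abs_sum_le_sum_abs _ _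

/-- The noiseless value of the quantity that is released with the noise variable of index `j`. -/
noncomputable def treeValue (H : SimpleGraph W) (w : Sym2 W → ℝ≥0) (j : Finset W × W) : ℝ :=
  open Classical in
  if h : ∃ r, IsTop H j.1 r then
    if j.2 = splitVertex H j.1 h.choose then wdist H w h.choose j.2
    else if j.2 ∈ j.1 ∧ IsChild H (splitVertex H j.1 h.choose) j.2 then
      w s(splitVertex H j.1 h.choose, j.2)
    else 0
  else 0

/-- A subtree has only one top vertex, so the choice made in `treeValue` is harmless. -/
lemma treeValue_eq (hH : H.IsAcyclic) (w : Sym2 W → ℝ≥0) {T : Finset W} {r : W}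
    (hT : IsTop H T r) (x : W) :
    treeValue H w (T, x) = open Classical in
      if x = splitVertex H T r then wdist H w r x
      else if x ∈ T ∧ IsChild H (splitVertex H T r) x then w s(splitVertex H T r, x)
      else 0 := by
  have h : ∃ r, IsTop H T r := ⟨r, hT⟩
  have hr : h.choose = r := h.choose_spec.unique hH hT
  rw [treeValue, dif_pos h]
  dsimp only
  generalize h.choose = r' at hr ⊢
  subst hr
  rfl

section Visited

variable [DecidableEq W]

/-- The subtrees that are treated in the recursion that starts at `T`. -/
noncomputable def visited (H : SimpleGraph W) : ℕ → Finset W → W → Finset (Finset W)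
  | 0, _, _ => ∅
  | fuel + 1, T, r =>
    open Classical in
    if T.card ≤ 1 then ∅
    else insert T (((T.filter (fun c => IsChild H (splitVertex H T r) c)).biUnion
        (fun c => visited H fuel (desc H T c) c))
      ∪ visited H fuel (trunk H T (splitVertex H T r)) r)

/-- Each true quantity in the recursion is added to its own noise variable, so it can be moved into
the noise. The branching depends on the topology alone. -/
lemma rootedDist_eq_rootedDist_zero (hH : H.IsAcyclic) (w : Sym2 W → ℝ≥0)
    (X Y : Finset W × W → ℝ) (fuel : ℕ) {T : Finset W} {r : W} (x : W) (hT : IsTop H T r)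
    (hY : ∀ j : Finset W × W, j.1 ∈ visited H fuel T r → Y j = X j + treeValue H w j) :
    rootedDist H w X fuel T r x = rootedDist H 0 Y fuel T r x := by
  classical
  induction fuel generalizing T r with
  | zero => rfl
  | succ fuel ih =>
    rw [visited] at hY
    rw [rootedDist, rootedDist]
    have hs := hT.isSplit_splitVertex hH r
    dsimp only
    split_ifs with h₁ h₂
    · rfl
    · rw [if_neg h₁] at hY
      obtain ⟨hc, hvc, hcx⟩ := h₂.choose_spec
      rw [ih (hT.desc hH hc), hY (T, _) (Finset.mem_insert_self _ _),
        hY (T, _) (Finset.mem_insert_self _ _), treeValue_eq hH w hT, treeValue_eq hH w hT,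
        if_pos rfl, if_neg hvc.1.ne', if_pos ⟨hc, hvc⟩]
      · have h0 : wdist H 0 r (splitVertex H T r) = 0 := by
          obtain ⟨p, hp⟩ := ((hT.anc _ hs.1).reachable hH).some.toPath
          rw [wdist_eq_of_isPath hH _ p hp]
          simp
        simp only [h0, Pi.zero_apply, NNReal.coe_zero]
        ring
      · refine fun j hj => hY j (Finset.mem_insert_of_mem (Finset.mem_union_left _ ?_))
        exact Finset.mem_biUnion.2 ⟨_, Finset.mem_filter.2 ⟨hc, hvc⟩, hj⟩
    · rw [if_neg h₁] at hY
      refine ih (hT.trunk hH hs.1) fun j hj => ?_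
      exact hY j (Finset.mem_insert_of_mem (Finset.mem_union_right _ hj))

end Visited

variable [Fintype W]

/-- The edges of `H` inside the vertex set `T`. -/
noncomputable def edgesIn (H : SimpleGraph W) (T : Finset W) : Finset (Sym2 W) :=
  open Classical in Finset.univ.filter (fun e => e ∈ H.edgeSet ∧ ∀ x ∈ e, x ∈ T)

lemma mem_edgesIn {T : Finset W} {e : Sym2 W} :
    e ∈ edgesIn H T ↔ e ∈ H.edgeSet ∧ ∀ x ∈ e, x ∈ T := by simp [edgesIn]

lemma edgesIn_mono {T T' : Finset W} (h : T ⊆ T') : edgesIn H T ⊆ edgesIn H T' := by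
  intro e he
  rw [mem_edgesIn] at *
  exact ⟨he.1, fun x hx => h (he.2 x hx)⟩

lemma disjoint_edgesIn {T T' : Finset W} (h : Disjoint T T') :
    Disjoint (edgesIn H T) (edgesIn H T') := by
  rw [Finset.disjoint_left] at *
  intro e he he'
  rw [mem_edgesIn] at *
  induction e with
  | _ x y => exact h (he.2 x (by simp)) (he'.2 x (by simp))

/-- The total change of the edge weights inside `T`. -/
noncomputable def changeIn (H : SimpleGraph W) (w w' : Sym2 W → ℝ≥0) (T : Finset W) : ℝ :=
  ∑ e ∈ edgesIn H T, |(w e : ℝ) - w' e|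

lemma changeIn_nonneg (w w' : Sym2 W → ℝ≥0) (T : Finset W) : 0 ≤ changeIn H w w' T :=
  Finset.sum_nonneg fun _ _ => abs_nonneg _

lemma sum_changeIn_le (w w' : Sym2 W → ℝ≥0) {ι : Type*} (s : Finset ι) (f : ι → Finset W)
    {T : Finset W} (hf : ∀ i ∈ s, f i ⊆ T)
    (hd : ∀ i ∈ s, ∀ j ∈ s, i ≠ j → Disjoint (f i) (f j)) :
    ∑ i ∈ s, changeIn H w w' (f i) ≤ changeIn H w w' T := by
  classical
  unfold changeIn
  rw [← Finset.sum_biUnion fun i hi j hj hij => disjoint_edgesIn (hd i hi j hj hij)]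
  refine Finset.sum_le_sum_of_subset_of_nonneg ?_ fun _ _ _ => abs_nonneg _
  exact Finset.biUnion_subset.2 fun i hi => edgesIn_mono (hf i hi)

lemma changeIn_add_changeIn_le (w w' : Sym2 W → ℝ≥0) {T₁ T₂ T : Finset W} (h : Disjoint T₁ T₂)
    (h₁ : T₁ ⊆ T) (h₂ : T₂ ⊆ T) :
    changeIn H w w' T₁ + changeIn H w w' T₂ ≤ changeIn H w w' T := by
  have := sum_changeIn_le (H := H) w w' Finset.univ (fun b : Bool => if b then T₁ else T₂)
    (T := T) (by simp [h₁, h₂]) (by simp [h, h.symm])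
  simpa using this

/-- The change of the quantities released when the recursion treats `T`. -/
noncomputable def levelChange (H : SimpleGraph W) (w w' : Sym2 W → ℝ≥0) (T : Finset W) : ℝ :=
  ∑ x : W, |treeValue H w (T, x) - treeValue H w' (T, x)|

lemma levelChange_nonneg (w w' : Sym2 W → ℝ≥0) (T : Finset W) : 0 ≤ levelChange H w w' T :=
  Finset.sum_nonneg fun _ _ => abs_nonneg _

variable [DecidableEq W]

/-- One split queries the path from `r` to the splitting vertex and the edges to its children. All
these edges are distinct and lie in `T`. -/
lemma levelChange_le (hH : H.IsAcyclic) (w w' : Sym2 W → ℝ≥0) {T : Finset W} {r : W}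
    (hT : IsTop H T r) : levelChange H w w' T ≤ changeIn H w w' T := by
  classical
  have hs := hT.isSplit_splitVertex hH r
  set v := splitVertex H T r with hv
  let C := T.filter (fun c => IsChild H v c)
  have hvC : v ∉ C := fun h => (Finset.mem_filter.1 h).2.1.ne rfl
  obtain ⟨p, hp⟩ := ((hT.anc _ hs.1).reachable hH).some.toPath
  have hmem := mem_support_iff_of_anc hH (hT.anc _ hs.1) p hp
  have h₁ : levelChange H w w' T
      = ∑ x ∈ insert v C, |treeValue H w (T, x) - treeValue H w' (T, x)| := by
    refine (Finset.sum_subset (Finset.subset_univ _) fun x _ hx => ?_).symm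
    simp only [C, Finset.mem_insert, Finset.mem_filter, not_or] at hx
    rw [treeValue_eq hH w hT, treeValue_eq hH w' hT, ← hv, if_neg hx.1, if_neg hx.1, if_neg hx.2,
      if_neg hx.2]
    simp
  have h₂ : |treeValue H w (T, v) - treeValue H w' (T, v)|
      ≤ ∑ e ∈ p.edges.toFinset, |(w e : ℝ) - w' e| := by
    rw [treeValue_eq hH w hT, treeValue_eq hH w' hT, ← hv, if_pos rfl, if_pos rfl,
      wdist_eq_of_isPath hH w p hp, wdist_eq_of_isPath hH w' p hp]
    exact abs_sum_edges_sub_le w w' p hp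
  have h₃ : ∑ x ∈ C, |treeValue H w (T, x) - treeValue H w' (T, x)|
      = ∑ e ∈ C.image (fun c => s(v, c)), |(w e : ℝ) - w' e| := by
    rw [Finset.sum_image (fun a _ b _ h => Sym2.congr_right.1 h)]
    refine Finset.sum_congr rfl fun c hc => ?_
    have hc := Finset.mem_filter.1 hc
    rw [treeValue_eq hH w hT, treeValue_eq hH w' hT, ← hv, if_neg hc.2.1.ne', if_neg hc.2.1.ne',
      if_pos hc, if_pos hc]
  rw [h₁, Finset.sum_insert hvC, h₃]
  refine (add_le_add_left h₂ _).trans ?_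
  rw [← Finset.sum_union]
  · refine Finset.sum_le_sum_of_subset_of_nonneg ?_ fun _ _ _ => abs_nonneg _
    intro e he
    rw [Finset.mem_union, List.mem_toFinset, Finset.mem_image] at he
    rw [mem_edgesIn]
    rcases he with he | ⟨c, hc, rfl⟩
    · refine ⟨p.edges_subset_edgeSet he, fun x hx => ?_⟩
      have := (hmem x).1 (p.mem_support_of_mem_edges he hx)
      exact hT.between v hs.1 x this.1 this.2
    · have hc := Finset.mem_filter.1 hc
      refine ⟨hc.2.1, fun x hx => ?_⟩
      rcases Sym2.mem_iff.1 hx with rfl | rfl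
      exacts [hs.1, hc.1]
  -- If the edge to a child `c` were on the path to `v`, then `c` would be an ancestor of `v`.
  · rw [Finset.disjoint_left]
    intro e he he'
    obtain ⟨c, hc, rfl⟩ := Finset.mem_image.1 he'
    have hc := Finset.mem_filter.1 hc
    exact hc.2.not_anc hH ((hmem c).1 (p.snd_mem_support_of_mem_edges (List.mem_toFinset.1 he))).2

lemma sum_union_le_of_nonneg {ι : Type*} [DecidableEq ι] (s t : Finset ι) {f : ι → ℝ}
    (hf : ∀ i, 0 ≤ f i) : ∑ i ∈ s ∪ t, f i ≤ ∑ i ∈ s, f i + ∑ i ∈ t, f i := by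
  rw [← Finset.sum_union_inter]
  exact le_add_of_nonneg_right (Finset.sum_nonneg fun i _ => hf i)

lemma sum_biUnion_le_of_nonneg {ι κ : Type*} [DecidableEq ι] (s : Finset κ) (t : κ → Finset ι)
    {f : ι → ℝ} (hf : ∀ i, 0 ≤ f i) : ∑ i ∈ s.biUnion t, f i ≤ ∑ a ∈ s, ∑ i ∈ t a, f i := by
  classical
  induction s using Finset.induction_on with
  | empty => simp
  | insert a s ha ih =>
    rw [Finset.biUnion_insert, Finset.sum_insert ha]
    exact (sum_union_le_of_nonneg _ _ hf).trans (add_le_add_right ih _)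

/-- The current split costs `changeIn H w w' T` once. The pieces are vertex-disjoint, so together
they cost at most `Nat.clog 2 T.card - 1` times the same amount. -/
lemma sum_visited_le (hH : H.IsAcyclic) (w w' : Sym2 W → ℝ≥0) (fuel : ℕ) {T : Finset W} {r : W}
    (hT : IsTop H T r) :
    ∑ T' ∈ visited H fuel T r, levelChange H w w' T'
      ≤ Nat.clog 2 T.card * changeIn H w w' T := by
  classical
  induction fuel generalizing T r with
  | zero => rw [visited, Finset.sum_empty]; exact mul_nonneg (by simp) (changeIn_nonneg _ _ _)
  | succ fuel ih =>
    rw [visited]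
    split_ifs with h₁
    · rw [Finset.sum_empty]; exact mul_nonneg (by simp) (changeIn_nonneg _ _ _)
    have hs := hT.isSplit_splitVertex hH r
    set v := splitVertex H T r with hv
    let C := T.filter (fun c => IsChild H v c)
    have hnn := levelChange_nonneg (H := H) w w'
    set m : ℝ := Nat.clog 2 T.card - 1 with hm
    have hcl : ∀ T' : Finset W, 2 * T'.card ≤ T.card + 1 → (Nat.clog 2 T'.card : ℝ) ≤ m := by
      intro T' h
      have : ((Nat.clog 2 T'.card + 1 : ℕ) : ℝ) ≤ Nat.clog 2 T.card :=
        Nat.cast_le.2 (clog_add_one_le (not_le.1 h₁) h)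
      push_cast at this
      linarith
    have hchild : ∑ c ∈ C, ∑ T' ∈ visited H fuel (desc H T c) c, levelChange H w w' T'
        ≤ ∑ c ∈ C, m * changeIn H w w' (desc H T c) := by
      refine Finset.sum_le_sum fun c hc => ?_
      have hc := Finset.mem_filter.1 hc
      refine (ih (hT.desc hH hc.1)).trans ?_
      exact mul_le_mul_of_nonneg_right
        (hcl _ ((hs.2.2 c hc.1 hc.2).trans (Nat.le_succ _))) (changeIn_nonneg _ _ _)
    have htrunk : ∑ T' ∈ visited H fuel (trunk H T v) r, levelChange H w w' T'
        ≤ m * changeIn H w w' (trunk H T v) :=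
      (ih (hT.trunk hH hs.1)).trans
        (mul_le_mul_of_nonneg_right (hcl _ (hT.card_trunk_le hH hs)) (changeIn_nonneg _ _ _))
    have hm0 : 0 ≤ m := (Nat.cast_nonneg _).trans (hcl _ (hT.card_trunk_le hH hs))
    have hdisj : ∑ c ∈ C, changeIn H w w' (desc H T c) ≤
        changeIn H w w' (C.biUnion (fun c => desc H T c)) := by
      refine sum_changeIn_le w w' C _ (fun c hc => Finset.subset_biUnion_of_mem _ hc) ?_
      intro c hc c' hc' hne
      rw [Finset.disjoint_left]
      intro x hx hx'
      exact hne ((Finset.mem_filter.1 hc).2.eq_of_anc hH (Finset.mem_filter.1 hc').2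
        (mem_desc.1 hx).2 (mem_desc.1 hx').2)
    have hparts : changeIn H w w' (C.biUnion (fun c => desc H T c))
        + changeIn H w w' (trunk H T v) ≤ changeIn H w w' T := by
      refine changeIn_add_changeIn_le w w' ?_
        (Finset.biUnion_subset.2 fun c _ => desc_subset H T c) (trunk_subset H T v)
      rw [Finset.disjoint_left]
      intro x hx hx'
      obtain ⟨c, hc, hcx⟩ := Finset.mem_biUnion.1 hx
      have hc := Finset.mem_filter.1 hc
      exact (mem_trunk.1 hx').2 ⟨c, hc.1, hc.2, (mem_desc.1 hcx).2⟩
    have hlevel := levelChange_le hH w w' hT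
    have hins : ∑ T' ∈ insert T (C.biUnion (fun c => visited H fuel (desc H T c) c)
        ∪ visited H fuel (trunk H T v) r), levelChange H w w' T'
        ≤ levelChange H w w' T
          + (∑ c ∈ C, ∑ T' ∈ visited H fuel (desc H T c) c, levelChange H w w' T'
            + ∑ T' ∈ visited H fuel (trunk H T v) r, levelChange H w w' T') := by
      rw [Finset.insert_eq]
      refine (sum_union_le_of_nonneg _ _ hnn).trans ?_
      rw [Finset.sum_singleton]
      refine add_le_add_right ((sum_union_le_of_nonneg _ _ hnn).trans ?_) _
      exact add_le_add_left (sum_biUnion_le_of_nonneg _ _ hnn) _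
    refine hins.trans ?_
    rw [← Finset.mul_sum] at hchild
    have hmul := mul_le_mul_of_nonneg_left (hdisj.trans (le_sub_iff_add_le.2 hparts)) hm0
    have : (Nat.clog 2 T.card : ℝ) = m + 1 := by rw [hm]; ring
    rw [this]
    linarith

/-- All subtrees that are treated by the forest mechanism. -/
noncomputable def forestVisited (H : SimpleGraph W) : Finset (Finset W) :=
  (Finset.univ.image (root H)).biUnion
    (fun r => visited H (Fintype.card W) (treeOf H r) r)

/-- The noiseless values of all quantities released by the forest mechanism. -/
noncomputable def forestValue (H : SimpleGraph W) (w : Sym2 W → ℝ≥0) (j : Finset W × W) : ℝ :=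
  if j.1 ∈ forestVisited H then treeValue H w j else 0

lemma rootDist_eq_rootDist_zero (hH : H.IsAcyclic) (w : Sym2 W → ℝ≥0) (X : Finset W × W → ℝ)
    (x : W) : rootDist H w X x = rootDist H 0 (X + forestValue H w) x := by
  have h := rootedDist_eq_rootedDist_zero hH w X (X + forestValue H w) (Fintype.card W) x
    (isTop_treeOf hH x) fun j hj => by
      rw [Pi.add_apply, forestValue, if_pos]
      refine Finset.mem_biUnion.2 ⟨root H x, Finset.mem_image_of_mem _ (Finset.mem_univ x), ?_⟩
      rwa [treeOf_root]
  unfold rootDist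
  unfold treeOf at h
  convert h

lemma forestDist_eq_forestDist_zero (hH : H.IsAcyclic) (w : Sym2 W → ℝ≥0)
    (X : Finset W × W → ℝ) (x y : W) :
    forestDist H w X x y = forestDist H 0 (X + forestValue H w) x y := by
  unfold forestDist
  simp only [rootDist_eq_rootDist_zero hH w X]

lemma sum_abs_forestValue_sub_le (hH : H.IsAcyclic) (w w' : Sym2 W → ℝ≥0) :
    ∑ j, |forestValue H w j - forestValue H w' j|
      ≤ Nat.clog 2 (Fintype.card W) * changeIn H w w' Finset.univ := by
  classical
  have h₁ : ∑ j, |forestValue H w j - forestValue H w' j|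
      = ∑ T ∈ forestVisited H, levelChange H w w' T := by
    rw [Fintype.sum_prod_type, ← Finset.sum_subset (Finset.subset_univ (forestVisited H))]
    · refine Finset.sum_congr rfl fun T hT => ?_
      simp [forestValue, hT, levelChange]
    · intro T _ hT
      simp [forestValue, hT]
  rw [h₁]
  refine (sum_biUnion_le_of_nonneg _ _ (levelChange_nonneg w w')).trans ?_
  have h₂ : ∀ r ∈ Finset.univ.image (root H),
      ∑ T ∈ visited H (Fintype.card W) (treeOf H r) r, levelChange H w w' T
        ≤ Nat.clog 2 (Fintype.card W) * changeIn H w w' (treeOf H r) := by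
    intro r hr
    obtain ⟨x, -, rfl⟩ := Finset.mem_image.1 hr
    have := isTop_treeOf hH (root H x)
    rw [root_root] at this
    refine (sum_visited_le hH w w' _ this).trans ?_
    exact mul_le_mul_of_nonneg_right
      (Nat.cast_le.2 (Nat.clog_mono_right 2 (Finset.card_le_univ _))) (changeIn_nonneg _ _ _)
  refine (Finset.sum_le_sum h₂).trans ?_
  rw [← Finset.mul_sum]
  refine mul_le_mul_of_nonneg_left ?_ (Nat.cast_nonneg _)
  refine sum_changeIn_le w w' _ _ (fun _ _ => Finset.subset_univ _) ?_
  intro r hr r' hr' hne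
  obtain ⟨x, -, rfl⟩ := Finset.mem_image.1 hr
  obtain ⟨x', -, rfl⟩ := Finset.mem_image.1 hr'
  rw [Finset.disjoint_left]
  intro y hy hy'
  rw [mem_treeOf] at hy hy'
  have := root_eq_of_reachable (hy.trans hy'.symm)
  rw [root_root, root_root] at this
  exact hne this

end Sensitivity

end FVSRelease

namespace FVSRelease

/-! ### The Laplace law -/

section Laplace

lemma laplace_of_pos {b : ℝ} (hb : 0 < b) : laplace b =
    volume.withDensity (fun x => ENNReal.ofReal (1 / (2 * b) * Real.exp (-|x| / b))) :=
  if_pos hb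

lemma lintegral_laplace_density {b : ℝ} (hb : 0 < b) :
    ∫⁻ x, ENNReal.ofReal (1 / (2 * b) * Real.exp (-|x| / b)) = 1 := by
  have h : ∫ x : ℝ, 1 / (2 * b) * Real.exp (-|x| / b) = 1 := by
    rw [integral_comp_abs (f := fun x => 1 / (2 * b) * Real.exp (-x / b)), integral_const_mul]
    have h₁ : ∀ x : ℝ, Real.exp (-x / b) = Real.exp (-b⁻¹ * x) := fun x => by
      congr 1; field_simp
    simp only [h₁]
    rw [integral_exp_mul_Ioi (by simpa using hb)]
    simp only [mul_zero, Real.exp_zero]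
    field_simp
  have hi : Integrable (fun x : ℝ => 1 / (2 * b) * Real.exp (-|x| / b)) := by
    -- A non-integrable function has Bochner integral 0, but the integral was computed to be 1.
    by_contra hi
    rw [integral_undef hi] at h
    exact zero_ne_one h
  rw [← ofReal_integral_eq_lintegral_ofReal hi
    (Filter.Eventually.of_forall fun x => by positivity), h, ENNReal.ofReal_one]

instance isProbabilityMeasure_laplace (b : ℝ) : IsProbabilityMeasure (laplace b) := by
  by_cases hb : 0 < b
  · rw [laplace_of_pos hb]
    exact ⟨by rw [withDensity_apply _ MeasurableSet.univ, Measure.restrict_univ,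
      lintegral_laplace_density hb]⟩
  · rw [laplace, if_neg hb]
    infer_instance

/-- Tilting by `exp (|x| / (2 * b))` turns the density of scale `b` into twice the density of scale
`2 * b`. -/
lemma lintegral_exp_abs_laplace {b : ℝ} (hb : 0 < b) :
    ∫⁻ x, ENNReal.ofReal (Real.exp (|x| / (2 * b))) ∂(laplace b) = 2 := by
  rw [laplace_of_pos hb, lintegral_withDensity_eq_lintegral_mul _ (by fun_prop) (by fun_prop)]
  have h : ∀ x : ℝ, ((fun x => ENNReal.ofReal (1 / (2 * b) * Real.exp (-|x| / b)))
      * fun x => ENNReal.ofReal (Real.exp (|x| / (2 * b)))) x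
      = 2 * ENNReal.ofReal (1 / (2 * (2 * b)) * Real.exp (-|x| / (2 * b))) := by
    intro x
    rw [Pi.mul_apply, ← ENNReal.ofReal_mul (by positivity), ← ENNReal.ofReal_ofNat,
      ← ENNReal.ofReal_mul (by norm_num), mul_assoc, ← Real.exp_add, ← mul_assoc]
    congr 2
    · field_simp
    · congr 1
      field_simp
      ring
  rw [lintegral_congr h, lintegral_const_mul _ (by fun_prop),
    lintegral_laplace_density (by positivity), mul_one]

lemma map_add_laplace {b : ℝ} (hb : 0 < b) (a : ℝ) : (laplace b).map (· + a) =
    volume.withDensity (fun x => ENNReal.ofReal (1 / (2 * b) * Real.exp (-|x - a| / b))) := by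
  ext s hs
  rw [Measure.map_apply (by fun_prop) hs, laplace_of_pos hb,
    withDensity_apply _ (hs.preimage (by fun_prop)), withDensity_apply _ hs,
    ← lintegral_indicator (hs.preimage (by fun_prop)), ← lintegral_indicator hs,
    ← lintegral_add_right_eq_self (s.indicator _) a]
  congr 1
  ext x
  simp only [Set.indicator, Set.mem_preimage, add_sub_cancel_right]
  rfl

/-- The log likelihood ratio of the Laplace laws centred at `a` and `a'`. -/
noncomputable def logRatio (b a a' x : ℝ) : ℝ := (|x - a'| - |x - a|) / b

lemma measurable_logRatio (b a a' : ℝ) : Measurable (logRatio b a a') := by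
  unfold logRatio; fun_prop

lemma logRatio_self (b a x : ℝ) : logRatio b a a x = 0 := by simp [logRatio]

lemma logRatio_swap (b a a' x : ℝ) : logRatio b a' a x = - logRatio b a a' x := by
  unfold logRatio; ring

lemma abs_logRatio_le {b : ℝ} (hb : 0 < b) (a a' x : ℝ) :
    |logRatio b a a' x| ≤ |a - a'| / b := by
  rw [logRatio, abs_div, abs_of_pos hb]
  refine div_le_div_of_nonneg_right ?_ hb.le
  refine (abs_abs_sub_abs_le (x - a') (x - a)).trans_eq ?_
  congr 1
  ring

lemma map_add_laplace_eq_withDensity {b : ℝ} (hb : 0 < b) (a a' : ℝ) :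
    (laplace b).map (· + a) = ((laplace b).map (· + a')).withDensity
      (fun x => ENNReal.ofReal (Real.exp (logRatio b a a' x))) := by
  have hm := measurable_logRatio b a a'
  rw [map_add_laplace hb, map_add_laplace hb, ← withDensity_mul _ (by fun_prop) (by fun_prop)]
  congr 1
  ext x
  rw [Pi.mul_apply, ← ENNReal.ofReal_mul (by positivity), mul_assoc, ← Real.exp_add, logRatio]
  congr 4
  field_simp
  ring

end Laplace

/-! ### Products of measures -/

section Product

open ProbabilityTheory

variable {ι : Type*} [Fintype ι]

lemma lintegral_pi_prod (μ : ι → Measure ℝ) [∀ i, IsProbabilityMeasure (μ i)] (s : Finset ι)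
    {f : ι → ℝ → ℝ≥0∞} (hf : ∀ i, Measurable (f i)) :
    ∫⁻ x, ∏ i ∈ s, f i (x i) ∂(Measure.pi μ) = ∏ i ∈ s, ∫⁻ y, f i y ∂(μ i) := by
  rw [lintegral_prod_eq_prod_lintegral_of_indepFun s (fun i (x : ι → ℝ) => f i (x i))
    (iIndepFun_pi fun i => (hf i).aemeasurable) fun i => (hf i).comp (measurable_pi_apply i)]
  refine Finset.prod_congr rfl fun i _ => ?_
  exact (measurePreserving_eval μ i).lintegral_comp (hf i)

/-- It suffices to compare on boxes, where the restricted density is again a product over the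
coordinates. -/
lemma pi_withDensity (μ : ι → Measure ℝ) [∀ i, IsProbabilityMeasure (μ i)] {f : ι → ℝ → ℝ≥0∞}
    (hf : ∀ i, Measurable (f i)) [∀ i, SigmaFinite ((μ i).withDensity (f i))] :
    Measure.pi (fun i => (μ i).withDensity (f i))
      = (Measure.pi μ).withDensity (fun x => ∏ i, f i (x i)) := by
  refine Measure.pi_eq fun s hs => ?_
  have hbox := MeasurableSet.univ_pi hs
  rw [withDensity_apply _ hbox, ← lintegral_indicator hbox]
  have h : ∀ x : ι → ℝ, (Set.univ.pi s).indicator (fun x => ∏ i, f i (x i)) x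
      = ∏ i, (s i).indicator (f i) (x i) := by
    intro x
    by_cases hx : x ∈ Set.univ.pi s
    · rw [Set.indicator_of_mem hx]
      exact Finset.prod_congr rfl fun i _ => (Set.indicator_of_mem (hx i trivial) _).symm
    · rw [Set.indicator_of_notMem hx]
      rw [Set.mem_univ_pi, not_forall] at hx
      obtain ⟨i, hi⟩ := hx
      exact (Finset.prod_eq_zero (Finset.mem_univ i) (Set.indicator_of_notMem hi _)).symm
  rw [lintegral_congr h, lintegral_pi_prod μ _ fun i => (hf i).indicator (hs i)]
  refine Finset.prod_congr rfl fun i _ => ?_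
  rw [lintegral_indicator (hs i), withDensity_apply _ (hs i)]

/-- The law of independent Laplace variables of scale `b`, centred at the `a i`. -/
noncomputable def laplacePi (b : ℝ) (a : ι → ℝ) : Measure (ι → ℝ) :=
  (Measure.pi (fun _ : ι => laplace b)).map (· + a)

instance isProbabilityMeasure_map_add (b a : ℝ) :
    IsProbabilityMeasure ((laplace b).map (· + a)) :=
  Measure.isProbabilityMeasure_map (by fun_prop)

instance (b : ℝ) (a : ι → ℝ) : IsProbabilityMeasure (laplacePi b a) :=
  Measure.isProbabilityMeasure_map (by fun_prop)

lemma laplacePi_eq (b : ℝ) (a : ι → ℝ) :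
    laplacePi b a = Measure.pi (fun i => (laplace b).map (· + a i)) := by
  rw [← Measure.pi_map_pi (fun i => by fun_prop)]
  rfl

lemma laplacePi_eq_withDensity {b : ℝ} (hb : 0 < b) (a a' : ι → ℝ) :
    laplacePi b a = (laplacePi b a').withDensity
      (fun x => ENNReal.ofReal (Real.exp (∑ i, logRatio b (a i) (a' i) (x i)))) := by
  have : ∀ i, IsProbabilityMeasure (((laplace b).map (· + a' i)).withDensity
      (fun x => ENNReal.ofReal (Real.exp (logRatio b (a i) (a' i) x)))) := fun i => by
    rw [← map_add_laplace_eq_withDensity hb]; infer_instance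
  rw [laplacePi_eq, laplacePi_eq]
  simp_rw [fun i => map_add_laplace_eq_withDensity hb (a i) (a' i)]
  rw [pi_withDensity _ fun i => by have := measurable_logRatio b (a i) (a' i); fun_prop]
  congr 1
  ext x
  rw [Real.exp_sum, ENNReal.ofReal_prod_of_nonneg fun _ _ => (Real.exp_pos _).le]

/-! ### Indistinguishable measures -/

/-- The inequality of `(ε, δ)`-differential privacy for a pair of output laws. -/
def Indist {Ω : Type*} [MeasurableSpace Ω] (ε δ : ℝ) (μ ν : Measure Ω) : Prop :=
  ∀ O : Set Ω, MeasurableSet O → μ O ≤ ENNReal.ofReal (Real.exp ε) * ν O + ENNReal.ofReal δ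

lemma Indist.refl {Ω : Type*} [MeasurableSpace Ω] {ε δ : ℝ} (hε : 0 ≤ ε) (μ : Measure Ω) :
    Indist ε δ μ μ := by
  intro O _
  refine le_add_right ?_
  calc μ O = 1 * μ O := (one_mul _).symm
    _ ≤ _ := by
      gcongr
      rw [← ENNReal.ofReal_one]
      exact ENNReal.ofReal_le_ofReal (Real.one_le_exp hε)

lemma Indist.map {Ω Ω' : Type*} [MeasurableSpace Ω] [MeasurableSpace Ω'] {ε δ : ℝ}
    {μ ν : Measure Ω} (h : Indist ε δ μ ν) {f : Ω → Ω'} (hf : Measurable f) :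
    Indist ε δ (μ.map f) (ν.map f) := by
  intro O hO
  rw [Measure.map_apply hf hO, Measure.map_apply hf hO]
  exact h _ (hf hO)

/-- Composition of an `(ε₁, 0)` and an `(ε₂, δ)` guarantee for independent releases. -/
lemma Indist.prod {Ω Ω' : Type*} [MeasurableSpace Ω] [MeasurableSpace Ω'] {ε₁ ε₂ δ : ℝ}
    {μ μ' : Measure Ω} {ν ν' : Measure Ω'} [IsProbabilityMeasure μ] [IsProbabilityMeasure μ']
    [IsProbabilityMeasure ν] [IsProbabilityMeasure ν']
    (h₁ : Indist ε₁ 0 μ μ') (h₂ : Indist ε₂ δ ν ν') :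
    Indist (ε₁ + ε₂) δ (μ.prod ν) (μ'.prod ν') := by
  have hle : μ ≤ ENNReal.ofReal (Real.exp ε₁) • μ' := Measure.le_iff.2 fun s hs => by
    simpa using h₁ s hs
  intro O hO
  have hm := measurable_measure_prodMk_left (ν := ν') hO
  rw [Measure.prod_apply hO, Measure.prod_apply hO]
  -- The second factor is exchanged first, while `μ` still has mass one; this keeps `δ` free of the
  -- factor `exp ε₁`.
  calc ∫⁻ x, ν (Prod.mk x ⁻¹' O) ∂μ
      ≤ ∫⁻ x, (ENNReal.ofReal (Real.exp ε₂) * ν' (Prod.mk x ⁻¹' O) + ENNReal.ofReal δ) ∂μ :=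
        lintegral_mono fun x => h₂ _ (measurable_prodMk_left hO)
    _ = ENNReal.ofReal (Real.exp ε₂) * ∫⁻ x, ν' (Prod.mk x ⁻¹' O) ∂μ + ENNReal.ofReal δ := by
        rw [lintegral_add_right _ measurable_const, lintegral_const_mul _ hm, lintegral_const,
          measure_univ, mul_one]
    _ ≤ ENNReal.ofReal (Real.exp ε₂)
          * ∫⁻ x, ν' (Prod.mk x ⁻¹' O) ∂(ENNReal.ofReal (Real.exp ε₁) • μ')
          + ENNReal.ofReal δ := by
        gcongr
    _ = _ := by
        rw [lintegral_smul_measure, smul_eq_mul, ← mul_assoc, Real.exp_add,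
          ENNReal.ofReal_mul (Real.exp_pos _).le, mul_comm (ENNReal.ofReal (Real.exp ε₂))]

lemma Indist.prod_symm {Ω Ω' : Type*} [MeasurableSpace Ω] [MeasurableSpace Ω'] {ε₁ ε₂ δ : ℝ}
    {μ μ' : Measure Ω} {ν ν' : Measure Ω'} [IsProbabilityMeasure μ] [IsProbabilityMeasure μ']
    [IsProbabilityMeasure ν] [IsProbabilityMeasure ν']
    (h₁ : Indist ε₁ δ μ μ') (h₂ : Indist ε₂ 0 ν ν') :
    Indist (ε₁ + ε₂) δ (μ.prod ν) (μ'.prod ν') := by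
  rw [← Measure.prod_swap (μ := ν) (ν := μ), ← Measure.prod_swap (μ := ν') (ν := μ'), add_comm]
  exact (h₂.prod h₁).map measurable_swap

/-- The Laplace mechanism. -/
lemma indist_laplacePi {b ε : ℝ} (hb : 0 < b) {a a' : ι → ℝ} (h : ∑ i, |a i - a' i| ≤ b * ε) :
    Indist ε 0 (laplacePi b a) (laplacePi b a') := by
  intro O hO
  rw [ENNReal.ofReal_zero, add_zero, laplacePi_eq_withDensity hb a a', withDensity_apply _ hO]
  calc ∫⁻ x in O, ENNReal.ofReal (Real.exp (∑ i, logRatio b (a i) (a' i) (x i)))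
        ∂(laplacePi b a')
      ≤ ∫⁻ _ in O, ENNReal.ofReal (Real.exp ε) ∂(laplacePi b a') := by
        refine lintegral_mono fun x => ENNReal.ofReal_le_ofReal (Real.exp_le_exp.2 ?_)
        calc ∑ i, logRatio b (a i) (a' i) (x i) ≤ ∑ i, |a i - a' i| / b :=
              Finset.sum_le_sum fun i _ => (le_abs_self _).trans (abs_logRatio_le hb _ _ _)
          _ ≤ ε := by
              rw [← Finset.sum_div, div_le_iff₀ hb]; linarith
    _ = _ := by rw [setLIntegral_const]

/-- The privacy loss of a single Laplace query is subgaussian. -/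
lemma hasSubgaussianMGF_logRatio {b : ℝ} (hb : 0 < b) {a a' : ℝ} (h : |a - a'| ≤ 1) :
    HasSubgaussianMGF (fun x => logRatio b a a' x
      - ∫ y, logRatio b a a' y ∂((laplace b).map (· + a))) (1 / b ^ 2).toNNReal
      ((laplace b).map (· + a)) := by
  have hL : ∀ x, logRatio b a a' x ∈ Set.Icc (-(1 / b)) (1 / b) := fun x =>
    abs_le.1 ((abs_logRatio_le hb a a' x).trans (by gcongr))
  -- Hoeffding's lemma on an interval of length `2 / b` gives the variance proxy `(1 / b) ^ 2`.
  have := hasSubgaussianMGF_of_mem_Icc (μ := (laplace b).map (· + a))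
    (measurable_logRatio b a a').aemeasurable (Filter.Eventually.of_forall hL)
  convert this using 1
  rw [← NNReal.coe_inj, Real.coe_toNNReal _ (by positivity)]
  push_cast
  rw [Real.norm_of_nonneg (by have : 0 < 1 / b := by positivity
                              linarith)]
  field_simp
  ring

/-- The exponential of minus the loss is a likelihood ratio, so its mean is 1. The subgaussian bound
at `-1` then reads `exp m ≤ exp (1 / (2 * b ^ 2))` for the mean loss `m`. -/
lemma integral_logRatio_le {b : ℝ} (hb : 0 < b) {a a' : ℝ} (h : |a - a'| ≤ 1) :
    ∫ y, logRatio b a a' y ∂((laplace b).map (· + a)) ≤ 1 / (2 * b ^ 2) := by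
  set m := ∫ y, logRatio b a a' y ∂((laplace b).map (· + a)) with hm
  have h₁ := (hasSubgaussianMGF_logRatio hb h).mgf_le (-1)
  have hmeas := measurable_logRatio b a a'
  have h₂ : ∫ x, Real.exp (-logRatio b a a' x) ∂((laplace b).map (· + a)) = 1 := by
    rw [integral_eq_lintegral_of_nonneg_ae (Filter.Eventually.of_forall fun _ => (Real.exp_pos _).le)
      (by fun_prop)]
    have : ((laplace b).map (· + a')) Set.univ = 1 := measure_univ
    rw [map_add_laplace_eq_withDensity hb a' a, withDensity_apply _ MeasurableSet.univ,
      Measure.restrict_univ] at this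
    simp_rw [← logRatio_swap b a a', this, ENNReal.toReal_one]
  rw [← hm, mgf] at h₁
  have h₃ : ∀ x, Real.exp (-1 * (logRatio b a a' x - m))
      = Real.exp m * Real.exp (-logRatio b a a' x) := fun x => by
    rw [← Real.exp_add]; congr 1; ring
  simp_rw [h₃] at h₁
  rw [integral_const_mul, h₂, mul_one, Real.exp_le_exp, Real.coe_toNNReal _ (by positivity)] at h₁
  refine h₁.trans_eq ?_
  field_simp

/-- Advanced composition for Laplace queries of sensitivity at most one. -/
lemma indist_laplacePi_of_card {b t : ℝ} (hb : 0 < b) (ht : 0 ≤ t) {a a' : ι → ℝ} (s : Finset ι)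
    (hs : ∀ i ∉ s, a i = a' i) (h : ∀ i, |a i - a' i| ≤ 1) :
    Indist (s.card / (2 * b ^ 2) + t) (Real.exp (-t ^ 2 / (2 * (s.card / b ^ 2))))
      (laplacePi b a) (laplacePi b a') := by
  intro O hO
  set P := laplacePi b a with hP
  set L : (ι → ℝ) → ℝ := fun x => ∑ i, logRatio b (a i) (a' i) (x i) with hLdef
  have hLm : Measurable L :=
    Finset.measurable_sum _ fun i _ => (measurable_logRatio b _ _).comp (measurable_pi_apply i)
  set ε : ℝ := s.card / (2 * b ^ 2) + t
  have hset : MeasurableSet {x | L x ≤ ε} := measurableSet_le hLm measurable_const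
  -- Where the loss `L` is at most `ε` the density is at most `exp ε`; the rest of the space has
  -- small mass by the tail bound `h₂` for the centred losses.
  have h₁ : P (O ∩ {x | L x ≤ ε}) ≤ ENNReal.ofReal (Real.exp ε) * laplacePi b a' O := by
    rw [hP, laplacePi_eq_withDensity hb a a', withDensity_apply _ (hO.inter hset)]
    calc ∫⁻ x in O ∩ {x | L x ≤ ε}, ENNReal.ofReal (Real.exp (L x)) ∂(laplacePi b a')
        ≤ ∫⁻ _ in O ∩ {x | L x ≤ ε}, ENNReal.ofReal (Real.exp ε) ∂(laplacePi b a') := by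
          refine setLIntegral_mono measurable_const fun x hx => ?_
          exact ENNReal.ofReal_le_ofReal (Real.exp_le_exp.2 hx.2)
      _ = ENNReal.ofReal (Real.exp ε) * laplacePi b a' (O ∩ {x | L x ≤ ε}) :=
          setLIntegral_const _ _
      _ ≤ _ := by gcongr; exact Set.inter_subset_left
  let Y : ι → ℝ → ℝ := fun i y => logRatio b (a i) (a' i) y
    - ∫ z, logRatio b (a i) (a' i) z ∂((laplace b).map (· + a i))
  have hind : iIndepFun (fun i (x : ι → ℝ) => Y i (x i)) P := by
    rw [hP, laplacePi_eq]
    exact iIndepFun_pi fun i => ((measurable_logRatio b _ _).sub_const _).aemeasurable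
  have hsub : ∀ i ∈ s, HasSubgaussianMGF (fun x : ι → ℝ => Y i (x i)) (1 / b ^ 2).toNNReal P := by
    intro i _
    rw [hP, laplacePi_eq]
    refine HasSubgaussianMGF.of_map (Y := (Function.eval i : (ι → ℝ) → ℝ)) (X := Y i)
      (measurable_pi_apply i).aemeasurable ?_
    rw [(measurePreserving_eval (fun i => (laplace b).map (· + a i)) i).map_eq]
    exact hasSubgaussianMGF_logRatio hb (h i)
  have h₂ := HasSubgaussianMGF.measure_sum_ge_le_of_iIndepFun hind hsub ht
  have h₃ : P {x | L x ≤ ε}ᶜ ≤ ENNReal.ofReal (Real.exp (-t ^ 2 / (2 * (s.card / b ^ 2)))) := by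
    have hle : P.real {x | t ≤ ∑ i ∈ s, Y i (x i)}
        ≤ Real.exp (-t ^ 2 / (2 * (s.card / b ^ 2))) := by
      refine h₂.trans_eq ?_
      congr 3
      rw [Finset.sum_const, nsmul_eq_mul]
      push_cast
      rw [Real.coe_toNNReal _ (by positivity)]
      ring
    refine (measure_mono fun x hx => ?_).trans
      ((ENNReal.le_ofReal_iff_toReal_le (measure_ne_top _ _) (Real.exp_pos _).le).2 hle)
    rw [Set.mem_compl_iff, Set.mem_ofPred_eq, not_le] at hx
    rw [Set.mem_ofPred_eq]
    have hLs : L x = ∑ i ∈ s, logRatio b (a i) (a' i) (x i) := by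
      refine (Finset.sum_subset (Finset.subset_univ s) fun i _ hi => ?_).symm
      rw [hs i hi, logRatio_self]
    have hmean : ∑ i ∈ s, ∫ z, logRatio b (a i) (a' i) z ∂((laplace b).map (· + a i))
        ≤ s.card / (2 * b ^ 2) := by
      refine (Finset.sum_le_sum fun i _ => integral_logRatio_le hb (h i)).trans_eq ?_
      rw [Finset.sum_const, nsmul_eq_mul]
      ring
    rw [Finset.sum_sub_distrib, ← hLs]
    simp only [ε] at hx
    linarith
  calc P O ≤ P (O ∩ {x | L x ≤ ε} ∪ {x | L x ≤ ε}ᶜ) := by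
        refine measure_mono fun x hx => ?_
        by_cases hx' : x ∈ {x | L x ≤ ε}
        exacts [Or.inl ⟨hx, hx'⟩, Or.inr hx']
    _ ≤ _ := (measure_union_le _ _).trans (add_le_add h₁ h₃)

/-! ### Tail bounds -/

/-- Chernoff bound with exponent `1 / (2 * b)`, where each variable has exponential moment 2. -/
lemma measure_sum_abs_gt_le {b t : ℝ} (hb : 0 < b) (J : Finset ι) :
    Measure.pi (fun _ : ι => laplace b) {x | t < ∑ j ∈ J, |x j|}
      ≤ ENNReal.ofReal (2 ^ J.card * Real.exp (-t / (2 * b))) := by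
  set f : (ι → ℝ) → ℝ≥0∞ := fun x => ENNReal.ofReal (Real.exp (-t / (2 * b)))
    * ∏ j ∈ J, ENNReal.ofReal (Real.exp (|x j| / (2 * b))) with hf
  have hfm : Measurable f := by fun_prop
  have hint : ∫⁻ x, f x ∂(Measure.pi (fun _ : ι => laplace b))
      = ENNReal.ofReal (2 ^ J.card * Real.exp (-t / (2 * b))) := by
    rw [lintegral_const_mul _ (by fun_prop), lintegral_pi_prod (fun _ : ι => laplace b) J
      (f := fun _ y => ENNReal.ofReal (Real.exp (|y| / (2 * b)))) (fun _ => by fun_prop)]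
    simp_rw [lintegral_exp_abs_laplace hb]
    rw [Finset.prod_const, mul_comm, ENNReal.ofReal_mul (by positivity),
      ENNReal.ofReal_pow (by norm_num), ENNReal.ofReal_ofNat]
  rw [← hint]
  refine meas_le_lintegral₀ hfm.aemeasurable fun x hx => ?_
  rw [hf]
  dsimp only
  rw [← ENNReal.ofReal_prod_of_nonneg fun _ _ => (Real.exp_pos _).le,
    ← ENNReal.ofReal_mul (Real.exp_pos _).le, ← Real.exp_sum, ← Real.exp_add, ← Finset.sum_div,
    ENNReal.one_le_ofReal]
  refine Real.one_le_exp ?_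
  rw [← add_div]
  have : t < ∑ j ∈ J, |x j| := hx
  exact div_nonneg (by linarith) (by linarith)

/-- With probability at least `1 - γ`, all of the given sums of Laplace variables are small. -/
lemma measure_exists_sum_abs_gt_le {κ : Type*} {b γ : ℝ} (hb : 0 < b) (hγ : 0 < γ) (A : Finset κ)
    (J : κ → Finset ι) {m : ℕ} (hJ : ∀ a ∈ A, (J a).card ≤ m) :
    Measure.pi (fun _ : ι => laplace b)
        {x | ∃ a ∈ A, 2 * b * (Real.log (A.card / γ) + m) < ∑ j ∈ J a, |x j|}
      ≤ ENNReal.ofReal γ := by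
  rcases A.eq_empty_or_nonempty with rfl | hA
  · simp
  have hc : 0 < (A.card : ℝ) := Nat.cast_pos.2 hA.card_pos
  set t := 2 * b * (Real.log (A.card / γ) + m) with ht
  have hone : ∀ a ∈ A, Measure.pi (fun _ : ι => laplace b) {x | t < ∑ j ∈ J a, |x j|}
      ≤ ENNReal.ofReal (γ / A.card) := by
    intro a ha
    refine (measure_sum_abs_gt_le hb (J a)).trans (ENNReal.ofReal_le_ofReal ?_)
    have h₁ : Real.exp (-t / (2 * b)) = γ / A.card * Real.exp (-(m : ℝ)) := by
      have : -t / (2 * b) = -Real.log (A.card / γ) + -(m : ℝ) := by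
        rw [ht]; field_simp; ring
      rw [this, Real.exp_add, Real.exp_neg, Real.exp_log (by positivity), inv_div]
    -- The summand `m` in the threshold pays for the moments, and the logarithm pays for the union
    -- bound.
    have h₂ : (2 : ℝ) ^ (J a).card ≤ Real.exp m := by
      calc (2 : ℝ) ^ (J a).card ≤ 2 ^ m := pow_le_pow_right₀ one_le_two (hJ a ha)
        _ ≤ Real.exp 1 ^ m := by
          gcongr
          linarith [Real.add_one_le_exp 1]
        _ = Real.exp m := by rw [← Real.exp_nat_mul, mul_one]
    calc (2 : ℝ) ^ (J a).card * Real.exp (-t / (2 * b))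
        ≤ Real.exp m * (γ / A.card * Real.exp (-(m : ℝ))) := by rw [h₁]; gcongr
      _ = γ / A.card := by rw [Real.exp_neg]; field_simp
  have hset : {x : ι → ℝ | ∃ a ∈ A, t < ∑ j ∈ J a, |x j|}
      = ⋃ a ∈ A, {x | t < ∑ j ∈ J a, |x j|} := by ext; simp
  rw [hset]
  calc _ ≤ ∑ a ∈ A, Measure.pi (fun _ : ι => laplace b) {x | t < ∑ j ∈ J a, |x j|} :=
        measure_biUnion_finset_le _ _
    _ ≤ ∑ a ∈ A, ENNReal.ofReal (γ / A.card) := Finset.sum_le_sum hone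
    _ = ENNReal.ofReal γ := by
        rw [Finset.sum_const, nsmul_eq_mul, ← ENNReal.ofReal_natCast,
          ← ENNReal.ofReal_mul hc.le]
        congr 1
        field_simp

end Product

end FVSRelease

namespace FVSRelease

open SimpleGraph

/-! ### Shortest path distances -/

section Distance

variable {V : Type u} {G : SimpleGraph V}

lemma bddBelow_path_weights (w : Sym2 V → ℝ≥0) (u v : V) :
    BddBelow (Set.range fun p : G.Path u v =>
      ((p : G.Walk u v).edges.map (fun e => (w e : ℝ))).sum) := by
  refine ⟨0, ?_⟩
  rintro _ ⟨p, rfl⟩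
  refine List.sum_nonneg fun x hx => ?_
  obtain ⟨e, -, rfl⟩ := List.mem_map.1 hx
  exact NNReal.coe_nonneg _

lemma wdist_le_of_isPath (w : Sym2 V → ℝ≥0) {u v : V} (p : G.Walk u v) (hp : p.IsPath) :
    wdist G w u v ≤ (p.edges.map (fun e => (w e : ℝ))).sum :=
  ciInf_le (bddBelow_path_weights w u v) ⟨p, hp⟩

lemma wdist_le_of_walk (w : Sym2 V → ℝ≥0) {u v : V} (p : G.Walk u v) :
    wdist G w u v ≤ (p.edges.map (fun e => (w e : ℝ))).sum := by
  classical
  refine (wdist_le_of_isPath w _ p.toPath.2).trans ?_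
  rw [← Multiset.sum_coe, ← Multiset.sum_coe, ← Multiset.map_coe, ← Multiset.map_coe]
  have hle : (p.toPath.1.edges : Multiset (Sym2 V)) ≤ p.edges :=
    (Multiset.le_iff_subset (Multiset.coe_nodup.2 p.toPath.2.isTrail.edges_nodup)).2
      fun e he => p.edges_toPath_subset_edges he
  obtain ⟨m, hm⟩ := Multiset.le_iff_exists_add.1 hle
  rw [hm, Multiset.map_add, Multiset.sum_add]
  refine le_add_of_nonneg_right (Multiset.sum_nonneg fun x hx => ?_)
  obtain ⟨e, -, rfl⟩ := Multiset.mem_map.1 hx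
  exact NNReal.coe_nonneg _

lemma wdist_zero (u v : V) : wdist G 0 u v = 0 := by
  have h : ∀ p : G.Path u v,
      ((p : G.Walk u v).edges.map (fun e => (((0 : Sym2 V → ℝ≥0) e : ℝ≥0) : ℝ))).sum = 0 :=
    fun p => by simp
  rw [wdist, iInf_congr h, Real.iInf_const_zero]

variable [Fintype V]

lemma exists_path_eq_wdist (w : Sym2 V → ℝ≥0) {u v : V} (h : G.Reachable u v) :
    ∃ p : G.Walk u v, p.IsPath ∧ wdist G w u v = (p.edges.map (fun e => (w e : ℝ))).sum := by
  classical
  have : Nonempty (G.Path u v) := ⟨h.some.toPath⟩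
  obtain ⟨p, hp⟩ := exists_eq_ciInf_of_finite
    (f := fun p : G.Path u v => ((p : G.Walk u v).edges.map (fun e => (w e : ℝ))).sum)
  exact ⟨p.1, p.2, hp.symm⟩

/-- Evaluate `w` on a shortest path for `w'`; a path uses each edge at most once. -/
lemma wdist_sub_le (w w' : Sym2 V → ℝ≥0) {u v : V} (h : G.Reachable u v) :
    wdist G w u v - wdist G w' u v ≤ changeIn G w w' Finset.univ := by
  classical
  obtain ⟨p, hp, hpw⟩ := exists_path_eq_wdist w' h
  rw [hpw]
  calc _ ≤ (p.edges.map (fun e => (w e : ℝ))).sum - (p.edges.map (fun e => (w' e : ℝ))).sum :=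
        sub_le_sub_right (wdist_le_of_isPath w p hp) _
    _ ≤ ∑ e ∈ p.edges.toFinset, |(w e : ℝ) - w' e| :=
        (le_abs_self _).trans (abs_sum_edges_sub_le w w' p hp)
    _ ≤ changeIn G w w' Finset.univ := by
        refine Finset.sum_le_sum_of_subset_of_nonneg (fun e he => ?_) fun _ _ _ => abs_nonneg _
        exact mem_edgesIn.2 ⟨p.edges_subset_edgeSet (List.mem_toFinset.1 he), by simp⟩

lemma changeIn_comm (w w' : Sym2 V → ℝ≥0) (T : Finset V) :
    changeIn G w w' T = changeIn G w' w T :=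
  Finset.sum_congr rfl fun _ _ => abs_sub_comm _ _

lemma abs_wdist_sub_le (w w' : Sym2 V → ℝ≥0) {u v : V} (h : G.Reachable u v) :
    |wdist G w u v - wdist G w' u v| ≤ changeIn G w w' Finset.univ :=
  abs_sub_le_iff.2 ⟨wdist_sub_le w w' h, changeIn_comm w w' Finset.univ ▸ wdist_sub_le w' w h⟩

lemma Neighboring.changeIn_le [DecidableEq V] {w w' : Sym2 V → ℝ≥0} (h : Neighboring G w w') :
    changeIn G w w' Finset.univ ≤ 1 := by
  classical
  refine le_trans (le_of_eq ?_) h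
  refine Finset.sum_congr ?_ fun _ _ => rfl
  ext e
  simp [mem_edgesIn]

lemma changeIn_induce_le [DecidableEq V] (s : Set V) [Fintype s] (w w' : Sym2 V → ℝ≥0) :
    changeIn (G.induce s) (fun e => w (e.map Subtype.val)) (fun e => w' (e.map Subtype.val))
      Finset.univ ≤ changeIn G w w' Finset.univ := by
  classical
  unfold changeIn
  have hinj : Function.Injective (Sym2.map (Subtype.val : s → V)) :=
    Sym2.map.injective Subtype.val_injective
  rw [← Finset.sum_image (s := edgesIn (G.induce s) Finset.univ)
    (g := Sym2.map (Subtype.val : s → V)) (f := fun e => |(w e : ℝ) - w' e|)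
    fun _ _ _ _ h => hinj h]
  refine Finset.sum_le_sum_of_subset_of_nonneg (fun e he => ?_) fun _ _ _ => abs_nonneg _
  obtain ⟨e, he', rfl⟩ := Finset.mem_image.1 he
  rw [mem_edgesIn] at he' ⊢
  refine ⟨?_, by simp⟩
  induction e with
  | _ x y => exact he'.1

end Distance

/-! ### Privacy -/

section Privacy

variable {V : Type u} [Fintype V] [DecidableEq V]

/-- No case distinction of the recursion looks at the noise, so each branch is a finite sum of
coordinates and constants. -/
lemma measurable_rootedDist {W : Type u} [DecidableEq W] (H : SimpleGraph W)
    (w : Sym2 W → ℝ≥0) (fuel : ℕ) (T : Finset W) (r x : W) :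
    Measurable fun X : Finset W × W → ℝ => rootedDist H w X fuel T r x := by
  induction fuel generalizing T r with
  | zero => exact measurable_const
  | succ fuel ih =>
    simp only [rootedDist]
    split_ifs with h₁ h₂
    · exact measurable_const
    · have := ih (desc H T h₂.choose) h₂.choose
      fun_prop
    · exact ih _ _

lemma measurable_forestDist {W : Type u} [Fintype W] [DecidableEq W] (H : SimpleGraph W)
    (w : Sym2 W → ℝ≥0) (x y : W) :
    Measurable fun X : Finset W × W → ℝ => forestDist H w X x y := by
  have h : ∀ z : W, Measurable fun X : Finset W × W → ℝ => rootDist H w X z :=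
    fun z => measurable_rootedDist _ _ _ _ _ _
  unfold forestDist
  split_ifs
  · exact measurable_coe_real_ereal.comp (((h x).add (h y)).sub ((h _).const_mul 2))
  · exact measurable_const

variable (G : SimpleGraph V) (S : Finset V)

lemma measurable_releasedDist (w : Sym2 V → ℝ≥0) :
    Measurable fun X : Noise S => releasedDist G S w X := by
  have htree : ∀ u v, Measurable fun X : Noise S => treeStep G S w X u v := fun u v =>
    (measurable_forestDist _ _ u v).comp measurable_fst
  have hinner : ∀ u v, Measurable fun X : Noise S => (innerStep G S w X u v : EReal) := by
    intro u v
    refine measurable_coe_real_ereal.comp ?_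
    unfold innerStep
    fun_prop
  have hedge : ∀ p v, Measurable fun X : Noise S => (noisyWeight S w X p v : EReal) := by
    intro u v
    refine measurable_coe_real_ereal.comp ?_
    unfold noisyWeight
    fun_prop
  have hlast : ∀ u v, Measurable fun X : Noise S => lastStep G S w X u v := fun u v =>
    Measurable.iInf fun p => (htree u p).add (hedge p v)
  have hcross : ∀ u v, Measurable fun X : Noise S => crossStep G S w X u v := fun u v =>
    Measurable.iInf fun p => (hlast u p).add (hinner p v)
  have houter : ∀ u v, Measurable fun X : Noise S => outerStep G S w X u v := fun u v =>
    (htree u v).min (Measurable.iInf fun p => (hcross u p).add (hcross v p))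
  refine measurable_pi_lambda _ fun u => measurable_pi_lambda _ fun v => ?_
  unfold releasedDist
  split_ifs with hu hv hv
  exacts [hinner u v, hcross ⟨v, hv⟩ u, hcross ⟨u, hu⟩ v, houter ⟨u, hu⟩ ⟨v, hv⟩]

/-- The noiseless values of the quantities to which the algorithm adds noise. -/
noncomputable def trueValues (w : Sym2 V → ℝ≥0) : Noise S :=
  open Classical in
  (forestValue (G.induce {v | v ∉ S}) (fun e => w (e.map Subtype.val)),
    fun p => if p ∈ S ×ˢ S then wdist G w p.1 p.2 else 0,
    fun e => if e ∈ G.edgeSet then w e else 0)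

variable {G S}

/-- The algorithm only uses the weights through the noisy values. -/
lemma releasedDist_eq (hS : IsFeedbackVertexSet G S) (w : Sym2 V → ℝ≥0) (X : Noise S) :
    releasedDist G S w X = releasedDist G S 0 (X + trueValues G S w) := by
  have htree : ∀ u v, treeStep G S w X u v = treeStep G S 0 (X + trueValues G S w) u v :=
    fun u v => forestDist_eq_forestDist_zero hS _ _ u v
  have hinner : ∀ u ∈ S, ∀ v ∈ S,
      innerStep G S w X u v = innerStep G S 0 (X + trueValues G S w) u v := by
    intro u hu v hv
    simp [innerStep, trueValues, wdist_zero, hu, hv, add_comm]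
  have hlast : ∀ u v, lastStep G S w X u v = lastStep G S 0 (X + trueValues G S w) u v := by
    intro u v
    refine iInf_congr fun p => ?_
    have : noisyWeight S w X p v = noisyWeight S 0 (X + trueValues G S w) p v := by
      simp [noisyWeight, trueValues, p.2, add_comm]
    rw [htree, this]
  have hcross : ∀ u, ∀ v ∈ S,
      crossStep G S w X u v = crossStep G S 0 (X + trueValues G S w) u v := by
    intro u v hv
    refine iInf_congr fun p => ?_
    rw [hlast, hinner p p.2 v hv]
  have houter : ∀ u v, outerStep G S w X u v = outerStep G S 0 (X + trueValues G S w) u v := by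
    intro u v
    unfold outerStep
    rw [htree, iInf_congr fun p : {p // p ∈ S} => by rw [hcross u p p.2, hcross v p p.2]]
  funext u v
  unfold releasedDist
  split_ifs with hu hv hv
  exacts [by rw [hinner u hu v hv], hcross _ u hu, hcross _ v hv, houter _ _]

lemma releaseLaw_eq (hS : IsFeedbackVertexSet G S) (w : Sym2 V → ℝ≥0) (ε δ : ℝ) :
    releaseLaw G S w ε δ =
      ((laplacePi ((Nat.clog 2 (Fintype.card {v // v ∉ S}) : ℝ) / (ε / 3))
          (trueValues G S w).1).prod
        ((laplacePi (2 * √2 * (S.card : ℝ) * √(Real.log (1 / δ)) / (ε / 3))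
            (trueValues G S w).2.1).prod
          (laplacePi (1 / (ε / 3)) (trueValues G S w).2.2))).map
        (fun X => releasedDist G S 0 X) := by
  unfold laplacePi
  rw [Measure.map_prod_map _ _ (by fun_prop) (by fun_prop),
    Measure.map_prod_map _ _ (by fun_prop) (by fun_prop),
    Measure.map_map (measurable_releasedDist G S 0) (by fun_prop)]
  unfold releaseLaw noiseLaw forestNoise
  congr 1
  funext X
  exact releasedDist_eq hS w X

lemma indist_trueValues_tree (hS : IsFeedbackVertexSet G S) {w w' : Sym2 V → ℝ≥0}
    (h : Neighboring G w w') {ε : ℝ} (hε : 0 < ε) :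
    Indist ε 0 (laplacePi ((Nat.clog 2 (Fintype.card {v // v ∉ S}) : ℝ) / ε) (trueValues G S w).1)
      (laplacePi ((Nat.clog 2 (Fintype.card {v // v ∉ S}) : ℝ) / ε) (trueValues G S w').1) := by
  have hsum : ∑ j, |(trueValues G S w).1 j - (trueValues G S w').1 j|
      ≤ Nat.clog 2 (Fintype.card {v // v ∉ S}) := by
    refine (sum_abs_forestValue_sub_le hS _ _).trans ?_
    refine mul_le_of_le_one_right (Nat.cast_nonneg _) ?_
    refine le_trans ?_ h.changeIn_le
    exact @changeIn_induce_le _ G _ _ {v | v ∉ S} _ w w'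
  -- At scale 0 there is no noise, but then the sensitivity is 0 as well and the two laws coincide.
  rcases (Nat.clog 2 (Fintype.card {v // v ∉ S})).eq_zero_or_pos with h0 | hpos
  · rw [h0, Nat.cast_zero] at hsum
    have heq : (trueValues G S w).1 = (trueValues G S w').1 := by
      funext j
      have h₁ := Finset.single_le_sum (f := fun j =>
        |(trueValues G S w).1 j - (trueValues G S w').1 j|) (fun _ _ => abs_nonneg _)
        (Finset.mem_univ j)
      exact sub_eq_zero.1 (abs_nonpos_iff.1 (h₁.trans hsum))
    rw [heq]
    exact Indist.refl hε.le _
  · have hpos' : (0 : ℝ) < Nat.clog 2 (Fintype.card {v // v ∉ S}) := Nat.cast_pos.2 hpos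
    refine indist_laplacePi (by positivity) ?_
    rwa [div_mul_cancel₀ _ hε.ne']

lemma indist_trueValues_edge {w w' : Sym2 V → ℝ≥0}
    (h : Neighboring G w w') {ε : ℝ} (hε : 0 < ε) :
    Indist ε 0 (laplacePi (1 / ε) (trueValues G S w).2.2)
      (laplacePi (1 / ε) (trueValues G S w').2.2) := by
  classical
  refine indist_laplacePi (by positivity) ?_
  rw [div_mul_cancel₀ _ hε.ne']
  refine le_trans (le_of_eq ?_) h
  rw [Finset.sum_filter]
  refine Finset.sum_congr rfl fun e _ => ?_
  by_cases he : e ∈ G.edgeSet <;> simp [trueValues, he]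

lemma indist_trueValues_inner (hG : G.Connected) {w w' : Sym2 V → ℝ≥0}
    (h : Neighboring G w w') {ε δ : ℝ} (hε : 0 < ε) (hδ : 0 < δ) (hδ' : δ < 1)
    (hεδ : ε ≤ 8 * Real.log (1 / δ)) :
    Indist ε δ
      (laplacePi (2 * √2 * (S.card : ℝ) * √(Real.log (1 / δ)) / ε) (trueValues G S w).2.1)
      (laplacePi (2 * √2 * (S.card : ℝ) * √(Real.log (1 / δ)) / ε) (trueValues G S w').2.1) := by
  rcases S.eq_empty_or_nonempty with rfl | hne
  · have : (trueValues G ∅ w).2.1 = (trueValues G ∅ w').2.1 := by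
      funext p; simp [trueValues]
    rw [this]
    exact Indist.refl hε.le _
  have hk : (0 : ℝ) < S.card := Nat.cast_pos.2 hne.card_pos
  set l := Real.log (1 / δ) with hl
  have hlpos : 0 < l := Real.log_pos (by rw [lt_div_iff₀ hδ]; linarith)
  set b := 2 * √2 * (S.card : ℝ) * √l / ε with hb
  have hbpos : 0 < b := by positivity
  have hb2 : b ^ 2 = 8 * (S.card : ℝ) ^ 2 * l / ε ^ 2 := by
    rw [hb, div_pow, mul_pow, mul_pow, mul_pow, Real.sq_sqrt hlpos.le,
      Real.sq_sqrt (by norm_num : (0 : ℝ) ≤ 2)]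
    ring
  have hcard : (((S ×ˢ S).card : ℕ) : ℝ) = (S.card : ℝ) ^ 2 := by
    rw [Finset.card_product]; push_cast; ring
  -- With deviation `ε / 2` the tail is exactly `exp (-l) = δ`. The mean loss is at most `ε ^ 2 /
  -- (16 * l)`, and this is at most `ε / 2` precisely when `ε ≤ 8 * l`.
  have key := indist_laplacePi_of_card hbpos (half_pos hε).le (a := (trueValues G S w).2.1)
    (a' := (trueValues G S w').2.1) (S ×ˢ S) (fun p hp => by simp only [trueValues, if_neg hp])
    (fun p => by
      by_cases hp : p ∈ S ×ˢ S
      · simp only [trueValues, if_pos hp]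
        exact (abs_wdist_sub_le w w' (hG p.1 p.2)).trans h.changeIn_le
      · simp only [trueValues, if_neg hp]
        simp)
  have h₁ : (((S ×ˢ S).card : ℕ) : ℝ) / (2 * b ^ 2) + ε / 2 ≤ ε := by
    have : (((S ×ˢ S).card : ℕ) : ℝ) / (2 * b ^ 2) = ε * ε / (16 * l) := by
      rw [hcard, hb2]; field_simp; norm_num
    rw [this]
    have : ε * ε / (16 * l) ≤ ε / 2 := by
      rw [div_le_div_iff₀ (by positivity) (by norm_num)]
      nlinarith
    linarith
  have h₂ : Real.exp (-(ε / 2) ^ 2 / (2 * ((((S ×ˢ S).card : ℕ) : ℝ) / b ^ 2))) = δ := by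
    have : -(ε / 2) ^ 2 / (2 * ((((S ×ˢ S).card : ℕ) : ℝ) / b ^ 2)) = -l := by
      rw [hcard, hb2]; field_simp; norm_num
    rw [this, hl, one_div, Real.log_inv, neg_neg, Real.exp_log hδ]
  rw [h₂] at key
  intro O hO
  refine (key O hO).trans ?_
  gcongr

lemma isDP_releaseLaw (hG : G.Connected) (hS : IsFeedbackVertexSet G S) {ε δ : ℝ} (hε : 0 < ε)
    (hδ : 0 < δ) (hδ' : δ < 1) (hεδ : ε / 3 ≤ 8 * Real.log (1 / δ)) :
    IsDP (Neighboring G) (fun w => releaseLaw G S w ε δ) ε δ := by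
  intro w w' h
  have hε3 : 0 < ε / 3 := by positivity
  have key := ((indist_trueValues_tree hS h hε3).prod
    ((indist_trueValues_inner (S := S) hG h hε3 hδ hδ' hεδ).prod_symm
      (indist_trueValues_edge (S := S) h hε3))).map (measurable_releasedDist G S 0)
  rw [← releaseLaw_eq hS, ← releaseLaw_eq hS, show ε / 3 + (ε / 3 + ε / 3) = ε by ring] at key
  exact key

end Privacy

end FVSRelease

namespace FVSRelease

open SimpleGraph

/-! ### Accuracy: deterministic part -/

section WalkWeight

variable {V : Type u} {G : SimpleGraph V}

/-- The total weight of a walk. -/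
def walkWeight (w : Sym2 V → ℝ≥0) {u v : V} (p : G.Walk u v) : ℝ :=
  (p.edges.map (fun e => (w e : ℝ))).sum

lemma walkWeight_cons (w : Sym2 V → ℝ≥0) {u v x : V} (h : G.Adj u v) (p : G.Walk v x) :
    walkWeight w (Walk.cons h p) = w s(u, v) + walkWeight w p := by simp [walkWeight]

lemma walkWeight_map {W : Type u} {H : SimpleGraph W} (w : Sym2 V → ℝ≥0) (f : H →g G) {u v : W}
    (p : H.Walk u v) : walkWeight w (p.map f) = walkWeight (fun e => w (e.map f)) p := by
  simp [walkWeight, Function.comp_def]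

lemma wdist_le_walkWeight (w : Sym2 V → ℝ≥0) {u v : V} (p : G.Walk u v) :
    wdist G w u v ≤ walkWeight w p := wdist_le_of_walk w p

lemma wdist_le_of_adj (w : Sym2 V → ℝ≥0) {u v : V} (h : G.Adj u v) :
    wdist G w u v ≤ w s(u, v) := by
  refine (wdist_le_walkWeight w h.toWalk).trans_eq ?_
  simp [walkWeight]

/-- A walk that starts outside of `S` stays outside of `S`, or it splits at its first vertex
in `S`. -/
lemma walk_cases (S : Finset V) (w : Sym2 V → ℝ≥0) {u v : V} (P : G.Walk u v) (hu : u ∉ S) :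
    (∃ hv : v ∉ S, ∃ p : (G.induce {v | v ∉ S}).Walk ⟨u, hu⟩ ⟨v, hv⟩,
      walkWeight (fun e => w (e.map Subtype.val)) p = walkWeight w P) ∨
    ∃ q : {v // v ∉ S}, ∃ x ∈ S, G.Adj q x ∧
      ∃ p : (G.induce {v | v ∉ S}).Walk ⟨u, hu⟩ q, ∃ R : G.Walk x v,
        walkWeight w P
          = walkWeight (fun e => w (e.map Subtype.val)) p + w s((q : V), x) + walkWeight w R := by
  induction P with
  | nil => exact Or.inl ⟨hu, Walk.nil, by simp [walkWeight]⟩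
  | @cons u u' v h P ih =>
    by_cases hu' : u' ∈ S
    · exact Or.inr ⟨⟨u, hu⟩, u', hu', h, Walk.nil, P, by rw [walkWeight_cons]; simp [walkWeight]⟩
    · have hadj : (G.induce {v | v ∉ S}).Adj ⟨u, hu⟩ ⟨u', hu'⟩ := h
      rcases ih hu' with ⟨hv, p, hp⟩ | ⟨q, x, hx, hqx, p, R, hp⟩
      · exact Or.inl ⟨hv, Walk.cons hadj p, by
          rw [walkWeight_cons, walkWeight_cons, hp]; rfl⟩
      · exact Or.inr ⟨q, x, hx, hqx, Walk.cons hadj p, R, by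
          rw [walkWeight_cons, walkWeight_cons, hp, Sym2.map_mk]; ring⟩

variable [Fintype V]

lemma exists_walkWeight_eq_wdist (hG : G.Connected) (w : Sym2 V → ℝ≥0) (u v : V) :
    ∃ p : G.Walk u v, wdist G w u v = walkWeight w p :=
  let ⟨p, _, hp⟩ := exists_path_eq_wdist w (hG u v)
  ⟨p, hp⟩

lemma wdist_triangle (hG : G.Connected) (w : Sym2 V → ℝ≥0) (u v x : V) :
    wdist G w u x ≤ wdist G w u v + wdist G w v x := by
  obtain ⟨p, hp⟩ := exists_walkWeight_eq_wdist hG w u v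
  obtain ⟨q, hq⟩ := exists_walkWeight_eq_wdist hG w v x
  rw [hp, hq]
  refine (wdist_le_walkWeight w (p.append q)).trans_eq ?_
  simp [walkWeight]

lemma wdist_comm_le (hG : G.Connected) (w : Sym2 V → ℝ≥0) (u v : V) :
    wdist G w u v ≤ wdist G w v u := by
  obtain ⟨p, hp⟩ := exists_walkWeight_eq_wdist hG w v u
  rw [hp]
  refine (wdist_le_walkWeight w p.reverse).trans_eq ?_
  simp [walkWeight]

lemma wdist_comm (hG : G.Connected) (w : Sym2 V → ℝ≥0) (u v : V) :
    wdist G w u v = wdist G w v u :=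
  (wdist_comm_le hG w u v).antisymm (wdist_comm_le hG w v u)

end WalkWeight

section Deterministic

variable {V : Type u} [Fintype V] [DecidableEq V] {G : SimpleGraph V} {S : Finset V}
  {w : Sym2 V → ℝ≥0} {X : Noise S} {E₁ E₂ E₃ : ℝ}

lemma coe_add_le_add {a b c : ℝ} {x y : EReal} (hx : (a : EReal) ≤ x) (hy : (b : EReal) ≤ y)
    (h : c ≤ a + b) : (c : EReal) ≤ x + y :=
  (EReal.coe_le_coe_iff.2 h).trans (by rw [EReal.coe_add]; exact add_le_add hx hy)

lemma add_le_coe_add {a b c : ℝ} {x y : EReal} (hx : x ≤ (a : EReal)) (hy : y ≤ (b : EReal))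
    (h : a + b ≤ c) : x + y ≤ (c : EReal) :=
  le_trans (by rw [EReal.coe_add]; exact add_le_add hx hy) (EReal.coe_le_coe_iff.2 h)

/-- All the noise that enters the released distances is small. -/
structure SmallNoise (G : SimpleGraph V) (S : Finset V) (X : Noise S) (E₁ E₂ E₃ : ℝ) : Prop where
  tree : ∀ x, ∑ j ∈ rootNoiseIndices (G.induce {v | v ∉ S}) x, |X.1 j| ≤ E₁
  inner : ∀ u ∈ S, ∀ v ∈ S, |X.2.1 (u, v)| ≤ E₂
  edge : ∀ p ∉ S, ∀ v ∈ S, |X.2.2 s(p, v)| ≤ E₃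

/-- The factor 4 is the sum of the absolute coefficients 1, 1 and 2 in the lowest common ancestor
formula. -/
lemma exists_treeStep_eq (hS : IsFeedbackVertexSet G S) (hX : SmallNoise G S X E₁ E₂ E₃)
    {u v : {v // v ∉ S}} (h : (G.induce {v | v ∉ S}).Reachable u v) : ∃ e : ℝ, |e| ≤ 4 * E₁ ∧
      treeStep G S w X u v = ((wdist (G.induce {v | v ∉ S})
        (fun e => w (e.map Subtype.val)) u v + e : ℝ) : EReal) := by
  refine ⟨_, ?_, forestDist_of_reachable hS _ X.1 h⟩
  have hb : ∀ x, |∑ j ∈ rootNoiseIndices (G.induce {v | v ∉ S}) x, X.1 j| ≤ E₁ := fun x =>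
    (Finset.abs_sum_le_sum_abs _ _).trans (hX.tree x)
  have h₁ := abs_le.1 (hb u)
  have h₂ := abs_le.1 (hb v)
  have h₃ := abs_le.1 (hb (lca (G.induce {v | v ∉ S}) u v))
  rw [abs_le]
  constructor <;> linarith

lemma le_treeStep (hS : IsFeedbackVertexSet G S) (hX : SmallNoise G S X E₁ E₂ E₃)
    (u v : {v // v ∉ S}) : ((wdist G w u v - 4 * E₁ : ℝ) : EReal) ≤ treeStep G S w X u v := by
  by_cases h : (G.induce {v | v ∉ S}).Reachable u v
  · obtain ⟨e, he, heq⟩ := exists_treeStep_eq (w := w) hS hX h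
    obtain ⟨p, -, hp⟩ := exists_path_eq_wdist (fun e => w (e.map Subtype.val)) h
    rw [heq, EReal.coe_le_coe_iff, hp]
    have h₁ := wdist_le_walkWeight w (p.map (Embedding.induce {v | v ∉ S}).toHom)
    rw [walkWeight_map] at h₁
    have h₂ := (abs_le.1 he).1
    have h₃ : wdist G w u v ≤ (p.edges.map fun e => ((w (e.map Subtype.val) : ℝ≥0) : ℝ)).sum := h₁
    linarith
  · exact le_top.trans_eq (forestDist_of_not_reachable _ _ h).symm

lemma treeStep_le (hS : IsFeedbackVertexSet G S) (hX : SmallNoise G S X E₁ E₂ E₃)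
    {u v : {v // v ∉ S}} (p : (G.induce {v | v ∉ S}).Walk u v) : treeStep G S w X u v
      ≤ ((walkWeight (fun e => w (e.map Subtype.val)) p + 4 * E₁ : ℝ) : EReal) := by
  obtain ⟨e, he, heq⟩ := exists_treeStep_eq (w := w) hS hX ⟨p⟩
  rw [heq, EReal.coe_le_coe_iff]
  have h₁ := wdist_le_walkWeight (fun e => w (e.map Subtype.val)) p
  have h₂ := (abs_le.1 he).2
  linarith

lemma le_lastStep (hG : G.Connected) (hS : IsFeedbackVertexSet G S)
    (hX : SmallNoise G S X E₁ E₂ E₃) (u : {v // v ∉ S}) {v : V} (hv : v ∈ S) :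
    ((wdist G w u v - (4 * E₁ + E₃) : ℝ) : EReal) ≤ lastStep G S w X u v := by
  refine le_iInf fun p => ?_
  refine coe_add_le_add (le_treeStep hS hX u p) le_rfl ?_
  have h₁ := wdist_triangle hG w u p v
  have h₂ := wdist_le_of_adj w p.2
  have h₃ := (abs_le.1 (hX.edge p p.1.2 v hv)).1
  rw [noisyWeight]
  linarith

lemma lastStep_le (hS : IsFeedbackVertexSet G S) (hX : SmallNoise G S X E₁ E₂ E₃)
    {u q : {v // v ∉ S}} {v : V} (hv : v ∈ S) (hq : G.Adj q v)
    (p : (G.induce {v | v ∉ S}).Walk u q) : lastStep G S w X u v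
      ≤ ((walkWeight (fun e => w (e.map Subtype.val)) p + w s((q : V), v)
        + (4 * E₁ + E₃) : ℝ) : EReal) := by
  refine (iInf_le _ ⟨q, hq⟩).trans ?_
  refine add_le_coe_add (treeStep_le hS hX p) le_rfl ?_
  have h₃ := (abs_le.1 (hX.edge q q.2 v hv)).2
  rw [noisyWeight]
  linarith

lemma le_crossStep (hG : G.Connected) (hS : IsFeedbackVertexSet G S)
    (hX : SmallNoise G S X E₁ E₂ E₃) (u : {v // v ∉ S}) {v : V} (hv : v ∈ S) :
    ((wdist G w u v - (4 * E₁ + E₂ + E₃) : ℝ) : EReal) ≤ crossStep G S w X u v := by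
  refine le_iInf fun p => ?_
  refine coe_add_le_add (le_lastStep hG hS hX u p.2) le_rfl ?_
  have h₁ := wdist_triangle hG w u p v
  have h₃ := (abs_le.1 (hX.inner p p.2 v hv)).1
  rw [innerStep]
  linarith

/-- A shortest path to `v ∈ S` must enter `S`; its first vertex `x` there and the predecessor `q` of
`x` are the witnesses for the two minima. -/
lemma crossStep_le (hG : G.Connected) (hS : IsFeedbackVertexSet G S)
    (hX : SmallNoise G S X E₁ E₂ E₃) (u : {v // v ∉ S}) {v : V} (hv : v ∈ S) :
    crossStep G S w X u v ≤ ((wdist G w u v + (4 * E₁ + E₂ + E₃) : ℝ) : EReal) := by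
  obtain ⟨P, hP⟩ := exists_walkWeight_eq_wdist hG w u v
  rcases walk_cases S w P u.2 with ⟨hv', -⟩ | ⟨q, x, hx, hqx, p, R, hPR⟩
  · exact absurd hv hv'
  refine (iInf_le _ ⟨x, hx⟩).trans ?_
  refine add_le_coe_add (lastStep_le hS hX hx hqx p) le_rfl ?_
  have h₁ := wdist_le_walkWeight w R
  have h₃ := (abs_le.1 (hX.inner x hx v hv)).2
  rw [innerStep, hP, hPR]
  dsimp only
  linarith

lemma le_outerStep (hG : G.Connected) (hS : IsFeedbackVertexSet G S)
    (hX : SmallNoise G S X E₁ E₂ E₃) (hE : 0 ≤ 4 * E₁ + 2 * E₂ + 2 * E₃)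
    (u v : {v // v ∉ S}) :
    ((wdist G w u v - 2 * (4 * E₁ + E₂ + E₃) : ℝ) : EReal) ≤ outerStep G S w X u v := by
  refine le_min ((EReal.coe_le_coe_iff.2 (by linarith)).trans (le_treeStep hS hX u v)) ?_
  refine le_iInf fun p => ?_
  refine coe_add_le_add (le_crossStep hG hS hX u p.2) (le_crossStep hG hS hX v p.2) ?_
  have h₁ := wdist_triangle hG w u p v
  rw [wdist_comm hG w p v] at h₁
  linarith

lemma outerStep_le (hG : G.Connected) (hS : IsFeedbackVertexSet G S)
    (hX : SmallNoise G S X E₁ E₂ E₃) (hE : 0 ≤ 4 * E₁ + 2 * E₂ + 2 * E₃)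
    (u v : {v // v ∉ S}) :
    outerStep G S w X u v ≤ ((wdist G w u v + 2 * (4 * E₁ + E₂ + E₃) : ℝ) : EReal) := by
  obtain ⟨P, hP⟩ := exists_walkWeight_eq_wdist hG w u v
  rcases walk_cases S w P u.2 with ⟨hv, p, hp⟩ | ⟨q, x, hx, hqx, p, R, hPR⟩
  · refine (min_le_left _ _).trans ((treeStep_le hS hX p).trans ?_)
    rw [EReal.coe_le_coe_iff, hp, hP]
    linarith
  · refine (min_le_right _ _).trans ((iInf_le _ ⟨x, hx⟩).trans ?_)
    -- The vertex `x` lies on a shortest path, so the two distances to it add up to at most the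
    -- distance from `u` to `v`.
    refine add_le_coe_add (crossStep_le hG hS hX u hx) (crossStep_le hG hS hX v hx) ?_
    have h₁ := wdist_le_walkWeight w R
    have h₂ := wdist_le_walkWeight w (p.map (Embedding.induce {v | v ∉ S}).toHom)
    rw [walkWeight_map] at h₂
    have h₂' : wdist G w u q ≤ walkWeight (fun e => w (e.map Subtype.val)) p := h₂
    have h₃ := wdist_triangle hG w u q x
    have h₄ := wdist_le_of_adj w hqx
    rw [wdist_comm hG w v x, hP, hPR]
    linarith

lemma releasedDist_mem (hG : G.Connected) (hS : IsFeedbackVertexSet G S)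
    (hX : SmallNoise G S X E₁ E₂ E₃) (h₁ : 0 ≤ E₁) (h₂ : 0 ≤ E₂) (h₃ : 0 ≤ E₃) (u v : V) :
    ((wdist G w u v - 2 * (4 * E₁ + E₂ + E₃) : ℝ) : EReal) ≤ releasedDist G S w X u v ∧
      releasedDist G S w X u v ≤ ((wdist G w u v + 2 * (4 * E₁ + E₂ + E₃) : ℝ) : EReal) := by
  have hcross : ∀ (u : {v // v ∉ S}) (v : V), v ∈ S →
      ((wdist G w u v - 2 * (4 * E₁ + E₂ + E₃) : ℝ) : EReal) ≤ crossStep G S w X u v ∧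
      crossStep G S w X u v ≤ ((wdist G w u v + 2 * (4 * E₁ + E₂ + E₃) : ℝ) : EReal) :=
    fun u v hv => ⟨(EReal.coe_le_coe_iff.2 (by linarith)).trans (le_crossStep hG hS hX u hv),
      (crossStep_le hG hS hX u hv).trans (EReal.coe_le_coe_iff.2 (by linarith))⟩
  unfold releasedDist
  split_ifs with hu hv hv
  · have := abs_le.1 (hX.inner u hu v hv)
    rw [innerStep, EReal.coe_le_coe_iff, EReal.coe_le_coe_iff]
    constructor <;> linarith [this.1, this.2]
  · rw [wdist_comm hG]
    exact hcross ⟨v, hv⟩ u hu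
  · exact hcross ⟨u, hu⟩ v hv
  · exact ⟨le_outerStep hG hS hX (by linarith) ⟨u, hu⟩ ⟨v, hv⟩,
      outerStep_le hG hS hX (by linarith) ⟨u, hu⟩ ⟨v, hv⟩⟩

end Deterministic

end FVSRelease

namespace FVSRelease

/-! ### Accuracy: probabilistic part -/

section Accuracy

variable {V : Type u} [Fintype V] [DecidableEq V] {G : SimpleGraph V} {S : Finset V}

/-- The error bound for the noise in the forest. -/
noncomputable def treeError (N : ℕ) (ε γ : ℝ) : ℝ :=
  2 * ((Nat.clog 2 N : ℝ) / (ε / 3)) * (Real.log (N / γ) + (2 * Nat.clog 2 N : ℕ))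

lemma measure_tree_bad_le {W : Type u} [Fintype W] [DecidableEq W] {H : SimpleGraph W}
    (hH : H.IsAcyclic) {ε γ : ℝ} (hε : 0 < ε) (hγ : 0 < γ) :
    forestNoise W (ε / 3)
      {x | ∃ a : W, treeError (Fintype.card W) ε γ < ∑ j ∈ rootNoiseIndices H a, |x j|}
      ≤ ENNReal.ofReal γ := by
  rcases (Nat.clog 2 (Fintype.card W)).eq_zero_or_pos with h0 | hpos
  · have hempty : ∀ a : W, rootNoiseIndices H a = ∅ := fun a => by
      have := card_rootNoiseIndices_le hH a
      rw [h0] at this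
      exact Finset.card_eq_zero.1 (Nat.le_zero.1 this)
    simp [treeError, h0, hempty]
  · have hpos' : (0 : ℝ) < Nat.clog 2 (Fintype.card W) := Nat.cast_pos.2 hpos
    have := measure_exists_sum_abs_gt_le
      (b := (Nat.clog 2 (Fintype.card W) : ℝ) / (ε / 3)) (by positivity) hγ
      (Finset.univ : Finset W) (rootNoiseIndices H) (fun a _ => card_rootNoiseIndices_le hH a)
    simpa [forestNoise, treeError] using this

/-- The error bound for `A` independent Laplace variables of scale `b`. -/
noncomputable def singleError (b : ℝ) (A : ℕ) (γ : ℝ) : ℝ := 2 * b * (Real.log (A / γ) + 1)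

lemma measure_single_bad_le {ι κ : Type*} [Fintype ι] (A : Finset κ) (f : κ → ι) {b γ : ℝ}
    (hb : A.Nonempty → 0 < b) (hγ : 0 < γ) :
    Measure.pi (fun _ : ι => laplace b) {x | ∃ a ∈ A, singleError b A.card γ < |x (f a)|}
      ≤ ENNReal.ofReal γ := by
  rcases A.eq_empty_or_nonempty with rfl | hA
  · simp
  · have := measure_exists_sum_abs_gt_le (hb hA) hγ A (fun a => {f a}) (m := 1) (by simp)
    simpa [singleError] using this

/-- Each of the three noise families fails with probability at most `γ`. The last two bounds are
conditional because an empty family imposes nothing, and for empty `S` the scale of the second one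
is 0. -/
lemma measure_smallNoise_ge (hS : IsFeedbackVertexSet G S) {ε δ γ E₁ E₂ E₃ : ℝ} (hε : 0 < ε)
    (hδ : 0 < δ) (hδ' : δ < 1) (hγ : 0 < γ)
    (h₁ : treeError (Fintype.card {v // v ∉ S}) ε γ ≤ E₁)
    (h₂ : (S ×ˢ S).Nonempty →
      singleError (2 * √2 * (S.card : ℝ) * √(Real.log (1 / δ)) / (ε / 3)) (S ×ˢ S).card γ ≤ E₂)
    (h₃ : (Sᶜ ×ˢ S).Nonempty → singleError (1 / (ε / 3)) (Sᶜ ×ˢ S).card γ ≤ E₃) :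
    ENNReal.ofReal (1 - 3 * γ) ≤ noiseLaw S ε δ {X | SmallNoise G S X E₁ E₂ E₃} := by
  set b₂ := 2 * √2 * (S.card : ℝ) * √(Real.log (1 / δ)) / (ε / 3) with hb₂
  have hlog : 0 < Real.log (1 / δ) := Real.log_pos (by rw [lt_div_iff₀ hδ]; linarith)
  have m₁ := measure_tree_bad_le (H := G.induce {v | v ∉ S}) hS hε hγ
  have m₂ := measure_single_bad_le (S ×ˢ S) id (b := b₂) (fun h => by
    have hk : (0 : ℝ) < S.card := Nat.cast_pos.2 h.fst.card_pos
    positivity) hγ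
  have m₃ := measure_single_bad_le (Sᶜ ×ˢ S) (fun p => s(p.1, p.2)) (b := 1 / (ε / 3))
    (fun _ => by positivity) hγ
  set B₁ : Set (Finset {v // v ∉ S} × {v // v ∉ S} → ℝ) :=
    {x | ∃ a : {v // v ∉ S}, treeError (Fintype.card {v // v ∉ S}) ε γ
      < ∑ j ∈ rootNoiseIndices (G.induce {v | v ∉ S}) a, |x j|}
  set B₂ : Set (V × V → ℝ) := {x | ∃ a ∈ S ×ˢ S, singleError b₂ (S ×ˢ S).card γ < |x (id a)|}
  set B₃ : Set (Sym2 V → ℝ) :=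
    {x | ∃ a ∈ Sᶜ ×ˢ S, singleError (1 / (ε / 3)) (Sᶜ ×ˢ S).card γ < |x s(a.1, a.2)|}
  have : IsProbabilityMeasure (forestNoise {v // v ∉ S} (ε / 3)) := by
    unfold forestNoise; infer_instance
  have : IsProbabilityMeasure (noiseLaw S ε δ) := by unfold noiseLaw; infer_instance
  let B : Set (Noise S) := B₁ ×ˢ Set.univ ∪ (Set.univ ×ˢ (B₂ ×ˢ Set.univ) ∪
    Set.univ ×ˢ (Set.univ ×ˢ B₃))
  have hB : noiseLaw S ε δ B ≤ ENNReal.ofReal (3 * γ) := by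
    refine (measure_union_le _ _).trans ((add_le_add_right (measure_union_le _ _) _).trans ?_)
    unfold noiseLaw
    simp only [Measure.prod_prod, measure_univ, mul_one, one_mul]
    rw [show 3 * γ = γ + (γ + γ) by ring, ENNReal.ofReal_add hγ.le (by linarith),
      ENNReal.ofReal_add hγ.le hγ.le]
    exact add_le_add m₁ (add_le_add m₂ m₃)
  have hcover : (Set.univ : Set (Noise S)) ⊆ {X | SmallNoise G S X E₁ E₂ E₃} ∪ B := by
    intro X _
    by_cases hX : X ∈ B
    · exact Or.inr hX
    simp only [B, Set.mem_union, Set.mem_prod, Set.mem_univ, and_true, true_and, not_or] at hX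
    obtain ⟨hX₁, hX₂, hX₃⟩ := hX
    simp only [B₁, B₂, B₃, Set.mem_ofPred_eq, not_exists, not_and, not_lt, id] at hX₁ hX₂ hX₃
    refine Or.inl ⟨fun x => (hX₁ x).trans h₁, fun u hu v hv => ?_, fun p hp v hv => ?_⟩
    · have hmem : (u, v) ∈ S ×ˢ S := Finset.mk_mem_product hu hv
      exact (hX₂ _ hmem).trans (h₂ ⟨_, hmem⟩)
    · have hmem : (p, v) ∈ Sᶜ ×ˢ S := Finset.mk_mem_product (Finset.mem_compl.2 hp) hv
      exact (hX₃ _ hmem).trans (h₃ ⟨_, hmem⟩)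
  rw [ENNReal.ofReal_sub _ (by linarith), ENNReal.ofReal_one, tsub_le_iff_right]
  calc (1 : ℝ≥0∞) = noiseLaw S ε δ Set.univ := measure_univ.symm
    _ ≤ _ := (measure_mono hcover).trans ((measure_union_le _ _).trans (by gcongr))

end Accuracy

/-! ### Bounds for the errors -/

section Numerics

/-- Rounding up adds at most 1, which is at most `log₂ n`, and `2 / log 2 < 3`. -/
lemma clog_le_three_mul_log {n : ℕ} (hn : 2 ≤ n) : (Nat.clog 2 n : ℝ) ≤ 3 * Real.log n := by
  have h₁ : 2 ^ (Nat.clog 2 n).pred < n := Nat.pow_pred_clog_lt_self one_lt_two hn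
  have hpos := Nat.clog_pos one_lt_two hn
  have h₂ : ((Nat.clog 2 n).pred : ℝ) * Real.log 2 ≤ Real.log n := by
    rw [← Real.log_pow]
    exact Real.log_le_log (by positivity) (by exact_mod_cast h₁.le)
  have h₃ : (Nat.clog 2 n : ℝ) = ((Nat.clog 2 n).pred : ℝ) + 1 := by
    rw [← Nat.succ_pred_eq_of_pos hpos]; push_cast; rfl
  have h₄ : Real.log 2 ≤ Real.log n := Real.log_le_log (by norm_num) (by exact_mod_cast hn)
  have h₅ := Real.log_two_gt_d9
  have h₆ : (0 : ℝ) ≤ (Nat.clog 2 n).pred := Nat.cast_nonneg _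
  rw [h₃]
  nlinarith

lemma one_le_log_inv {γ : ℝ} (hγ : 0 < γ) (hγ' : 3 * γ < 1) : 1 ≤ Real.log (1 / γ) := by
  rw [Real.le_log_iff_exp_le (by positivity), le_div_iff₀ hγ]
  nlinarith [Real.exp_one_lt_d9]

/-- Trades the exponent 2 obtained from the tail bounds for the exponent `5 / 2` of the theorem; it
is applied with `l ≥ log 2`. -/
lemma sq_le_two_mul_rpow {l : ℝ} (hl : 1 / 4 ≤ l) : l ^ 2 ≤ 2 * l ^ (5 / 2 : ℝ) := by
  have hl0 : 0 < l := by linarith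
  have h : l ^ (5 / 2 : ℝ) = l ^ 2 * √l := by
    rw [Real.sqrt_eq_rpow, ← Real.rpow_natCast, ← Real.rpow_add hl0]
    norm_num
  have h₂ : 1 / 2 ≤ √l := Real.le_sqrt_of_sq_le (by norm_num; linarith)
  rw [h]
  nlinarith [sq_nonneg l]

variable {n : ℕ} {ε γ : ℝ}

lemma treeError_le {N : ℕ} (hNn : N ≤ n) (hε : 0 < ε) (hγ : 0 < γ) (hγ' : 3 * γ < 1) :
    treeError N ε γ ≤ 306 * (ε⁻¹ * Real.log n ^ (5 / 2 : ℝ) * Real.log (1 / γ)) := by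
  have hg := one_le_log_inv hγ hγ'
  have hn0 : 0 ≤ Real.log n := Real.log_natCast_nonneg n
  rcases Nat.lt_or_ge N 2 with hN | hN
  · rw [treeError, Nat.clog_of_right_le_one (by omega)]
    simp only [Nat.cast_zero, zero_div, mul_zero, zero_mul]
    positivity
  have hN0 : (0 : ℝ) < N := by positivity
  have hlN : Real.log N ≤ Real.log n := Real.log_le_log hN0 (by exact_mod_cast hNn)
  have hl2 : Real.log 2 ≤ Real.log n :=
    Real.log_le_log (by norm_num) (by exact_mod_cast hN.trans hNn)
  have h69 := Real.log_two_gt_d9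
  have hc := (clog_le_three_mul_log hN).trans (mul_le_mul_of_nonneg_left hlN (by norm_num))
  have hlog : Real.log (N / γ) = Real.log N + Real.log (1 / γ) := by
    rw [div_eq_mul_one_div, Real.log_mul hN0.ne' (by positivity)]
  have hsq := sq_le_two_mul_rpow (l := Real.log n) (by linarith)
  rw [treeError, hlog]
  set l := Real.log n
  set g := Real.log (1 / γ)
  set c := (Nat.clog 2 N : ℝ) with hcdef
  have hc0 : 0 ≤ c := Nat.cast_nonneg _
  have hlN0 : 0 ≤ Real.log N := Real.log_natCast_nonneg N
  push_cast
  rw [← hcdef]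
  calc 2 * (c / (ε / 3)) * (Real.log N + g + 2 * c)
      = 6 * ε⁻¹ * (c * (Real.log N + g + 2 * c)) := by field_simp; ring
    -- Here `Real.log N + 2 * c ≤ 7 * l ≤ 7 * l * g` as `g ≥ 1`, and `g ≤ 1.5 * l * g` as `l ≥ log
    -- 2`.
    _ ≤ 6 * ε⁻¹ * (3 * l * (8.5 * l * g)) := by
        gcongr
        nlinarith
    _ = 153 * ε⁻¹ * g * l ^ 2 := by ring
    _ ≤ 153 * ε⁻¹ * g * (2 * l ^ (5 / 2 : ℝ)) := by gcongr
    _ = _ := by ring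

lemma edgeError_le {A : ℕ} (hA : 0 < A) (hn : 2 ≤ n) (hAn : A ≤ n ^ 2) (hε : 0 < ε) (hγ : 0 < γ)
    (hγ' : 3 * γ < 1) : singleError (1 / (ε / 3)) A γ
      ≤ 90 * (ε⁻¹ * Real.log n ^ (5 / 2 : ℝ) * Real.log (1 / γ)) := by
  have hg := one_le_log_inv hγ hγ'
  have hA0 : (0 : ℝ) < A := Nat.cast_pos.2 hA
  have hlA : Real.log A ≤ 2 * Real.log n := by
    have := Real.log_le_log hA0 (show (A : ℝ) ≤ (n : ℝ) ^ 2 by exact_mod_cast hAn)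
    rwa [Real.log_pow] at this
  have hl2 : Real.log 2 ≤ Real.log n := Real.log_le_log (by norm_num) (by exact_mod_cast hn)
  have h69 := Real.log_two_gt_d9
  have hlog : Real.log (A / γ) = Real.log A + Real.log (1 / γ) := by
    rw [div_eq_mul_one_div, Real.log_mul hA0.ne' (by positivity)]
  have hsq := sq_le_two_mul_rpow (l := Real.log n) (by linarith)
  rw [singleError, hlog]
  set l := Real.log n
  set g := Real.log (1 / γ)
  have h₁ : l ≤ 1.5 * l ^ 2 := by nlinarith
  have h₂ : (1 : ℝ) ≤ 2.25 * l ^ 2 := by nlinarith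
  have h₃ : (0 : ℝ) ≤ l ^ 2 := sq_nonneg l
  calc 2 * (1 / (ε / 3)) * (Real.log A + g + 1)
      = 6 * ε⁻¹ * (Real.log A + g + 1) := by field_simp; ring
    -- The constant is `2 * 1.5 + 2.25 + 2.25`, one summand for each term of the bracket.
    _ ≤ 6 * ε⁻¹ * (7.5 * l ^ 2 * g) := by
        gcongr
        nlinarith
    _ = 45 * ε⁻¹ * g * l ^ 2 := by ring
    _ ≤ 45 * ε⁻¹ * g * (2 * l ^ (5 / 2 : ℝ)) := by gcongr
    _ = _ := by ring

lemma innerError_le {k : ℕ} (hk : 0 < k) {r : ℝ} (hr : 0 ≤ r) (hε : 0 < ε) (hγ : 0 < γ)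
    (hγ' : 3 * γ < 1) : singleError (2 * √2 * (k : ℝ) * r / (ε / 3)) (k * k) γ
      ≤ 72 * (ε⁻¹ * k * Real.log (k / γ) * r) := by
  have hg := one_le_log_inv hγ hγ'
  have hk0 : (0 : ℝ) < k := Nat.cast_pos.2 hk
  have hlk : 0 ≤ Real.log k := Real.log_natCast_nonneg k
  have hlog : Real.log (k / γ) = Real.log k + Real.log (1 / γ) := by
    rw [div_eq_mul_one_div, Real.log_mul hk0.ne' (by positivity)]
  have hlog' : Real.log ((k * k : ℕ) / γ) = 2 * Real.log k + Real.log (1 / γ) := by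
    push_cast
    rw [div_eq_mul_one_div, Real.log_mul (by positivity) (by positivity),
      Real.log_mul hk0.ne' hk0.ne']
    ring
  have hsqrt : √2 ≤ 2 := Real.sqrt_le_iff.2 ⟨by norm_num, by norm_num⟩
  rw [singleError, hlog, hlog']
  set g := Real.log (1 / γ)
  calc 2 * (2 * √2 * (k : ℝ) * r / (ε / 3)) * (2 * Real.log k + g + 1)
      = 12 * ε⁻¹ * k * r * √2 * (2 * Real.log k + g + 1) := by field_simp; ring
    _ ≤ 12 * ε⁻¹ * k * r * 2 * (3 * (Real.log k + g)) := by
        gcongr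
        linarith
    _ = _ := by ring

end Numerics

lemma accuracy_releaseLaw {V : Type u} [Fintype V] [DecidableEq V] {G : SimpleGraph V}
    (hG : G.Connected) {S : Finset V} (hS : IsFeedbackVertexSet G S) {ε δ γ : ℝ} (hε : 0 < ε)
    (hδ : 0 < δ) (hδ' : δ < 1) (hγ : 0 < γ) (hγ' : 3 * γ < 1) (w : Sym2 V → ℝ≥0) {R : ℝ}
    (hR : 3000 * (ε⁻¹ * S.card * Real.log (S.card / γ) * √(Real.log (1 / δ))
      + ε⁻¹ * Real.log (Fintype.card V) ^ (5 / 2 : ℝ) * Real.log (1 / γ)) ≤ R) :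
    ENNReal.ofReal (1 - 3 * γ) ≤ releaseLaw G S w ε δ
      {D | ∀ u v : V, ((wdist G w u v - R : ℝ) : EReal) ≤ D u v ∧
        D u v ≤ ((wdist G w u v + R : ℝ) : EReal)} := by
  set U := ε⁻¹ * S.card * Real.log (S.card / γ) * √(Real.log (1 / δ)) with hU
  set T := ε⁻¹ * Real.log (Fintype.card V) ^ (5 / 2 : ℝ) * Real.log (1 / γ) with hT
  have hg := one_le_log_inv hγ hγ'
  have hT0 : 0 ≤ T := by
    have : 0 ≤ Real.log (Fintype.card V) := Real.log_natCast_nonneg _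
    positivity
  have hU0 : 0 ≤ U := by
    rcases S.card.eq_zero_or_pos with h | h
    · simp [hU, h]
    · have h₁ : (1 : ℝ) ≤ S.card := by exact_mod_cast h
      have : 0 ≤ Real.log (S.card / γ) := Real.log_nonneg (by
        rw [le_div_iff₀ hγ]; linarith)
      positivity
  have key := measure_smallNoise_ge (G := G) hS (E₁ := 306 * T) (E₂ := 72 * U) (E₃ := 90 * T)
    hε hδ hδ' hγ (treeError_le (Fintype.card_subtype_le _) hε hγ hγ')
    (fun h => by
      rw [Finset.card_product]
      exact innerError_le h.fst.card_pos (Real.sqrt_nonneg _) hε hγ hγ')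
    (fun h => by
      refine edgeError_le h.card_pos ?_ ?_ hε hγ hγ'
      · obtain ⟨p, hp⟩ := h
        rw [Finset.mem_product, Finset.mem_compl] at hp
        exact Fintype.one_lt_card_iff.2 ⟨p.1, p.2, fun h => hp.1 (h ▸ hp.2)⟩
      · rw [Finset.card_product, sq]
        exact Nat.mul_le_mul (Finset.card_le_univ _) (Finset.card_le_univ _))
  -- The total error is `2 * (4 * 306 * T + 72 * U + 90 * T) = 2628 * T + 144 * U`, which explains
  -- the constant 3000. The lower bound on the mass of an image measure holds for every set, so the
  -- event need not be shown measurable.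
  refine key.trans (le_trans (measure_mono fun X hX => ?_)
    (Measure.le_map_apply (measurable_releasedDist G S w).aemeasurable _))
  intro u v
  have h := releasedDist_mem (w := w) hG hS hX (by positivity) (by positivity) (by positivity) u v
  exact ⟨(EReal.coe_le_coe_iff.2 (by linarith)).trans h.1,
    h.2.trans (EReal.coe_le_coe_iff.2 (by linarith))⟩

end FVSRelease

theorem mainTheorem2 :
    ∃ C : ℝ, 0 < C ∧
      ∀ (V : Type u) [Fintype V] [DecidableEq V] (G : SimpleGraph V) (_ : G.Connected)
        (S : Finset V) (_ : FVSRelease.IsFeedbackVertexSet G S)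
        (ε δ : ℝ) (_ : 0 < ε) (_ : 0 < δ) (_ : δ < 1),
        (ε / 3 ≤ 8 * Real.log (1 / δ) →
          FVSRelease.IsDP (FVSRelease.Neighboring G)
            (fun w => FVSRelease.releaseLaw G S w ε δ) ε δ) ∧
        ∀ (w : Sym2 V → ℝ≥0) (γ : ℝ), 0 < γ →
          ENNReal.ofReal (1 - 3 * γ) ≤
            FVSRelease.releaseLaw G S w ε δ
              {D | ∀ u v : V,
                ((FVSRelease.wdist G w u v
                  - C * (ε⁻¹ * S.card * Real.log (S.card / γ) * √(Real.log (1 / δ))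
                    + ε⁻¹ * Real.log (Fintype.card V) ^ (5 / 2 : ℝ) * Real.log (1 / γ)) : ℝ)
                      : EReal) ≤ D u v ∧
                D u v ≤ ((FVSRelease.wdist G w u v
                  + C * (ε⁻¹ * S.card * Real.log (S.card / γ) * √(Real.log (1 / δ))
                    + ε⁻¹ * Real.log (Fintype.card V) ^ (5 / 2 : ℝ) * Real.log (1 / γ)) : ℝ)
                      : EReal)} := by
  refine ⟨3000, by norm_num, fun V _ _ G hG S hS ε δ hε hδ hδ' =>
    ⟨FVSRelease.isDP_releaseLaw hG hS hε hδ hδ', fun w γ hγ => ?_⟩⟩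
  -- For `3 * γ ≥ 1` the claimed probability is at most 0. Otherwise `log (1 / γ) ≥ 1`, which the
  -- numerical bounds need.
  rcases lt_or_ge (3 * γ) 1 with hγ' | hγ'
  · exact FVSRelease.accuracy_releaseLaw hG hS hε hδ hδ' hγ hγ' w le_rfl
  · rw [ENNReal.ofReal_of_nonpos (by linarith)]
    exact zero_le
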